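/- Let $K$ be an algebraically closed field of characteristic $p>0$, let $V$ be a $K$-vector space of finite dimension $n\ge 2$, and let $G=\operatorname{SL}(V)$ with Lie algebra $\mathfrak{g}=\mathfrak{sl}(V)$. Let $e\in\mathfrak{sl}(V)$ be a nilpotent element whose Jordan blocks on $V$ have sizes $d_1,\dots,d_t$ (with multiplicities, $t\ge 1$, all $d_r\ge 1$), and let $u\in G$ be a unipotent element whose Jordan blocks on $V$ have the same sizes $d_1,\dots,d_t$. Set $\alpha=\nu_p(\gcd(d_1,\dots,d_t))$, where $\nu_p$ is the $p$-adic valuation. Here $u$ acts on $\mathfrak{gl}(V)=\operatorname{End}(V)$ by $x\mapsto uxu^{-1}$ and $e$ acts by $x\mapsto [e,x]$; these maps preserve $\mathfrak{sl}(V)$ and induce actions on $\mathfrak{psl}(V)=\mathfrak{sl}(V)/Z(\mathfrak{sl}(V))$. Then: (i) $u$ and $e$ have the same Jordan block sizes (with multiplicities) on $\mathfrak{gl}(V)$, and also on $\mathfrak{sl}(V)$. (ii) Let $L_G(\varpi_1+\varpi_{n-1})$ be the rational irreducible $G$-module with highest weight $\varpi_1+\varpi_{n-1}$, where $\varpi_i$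 is the $i$-th fundamental dominant weight, and let $e$ act on it through the differential of the representation. It is isomorphic to $\mathfrak{psl}(V)$, compatibly with the actions of $G$ and of $e$. If $p\mid n$, then $u$ and $e$ have the same Jordan block sizes on $L_G(\varpi_1+\varpi_{n-1})\cong\mathfrak{psl}(V)$ if and only if $p^{\alpha+1}\mid n$. If $p\nmid n$, then $u$ and $e$ always have the same Jordan block sizes on $L_G(\varpi_1+\varpi_{n-1})\cong\mathfrak{psl}(V)$. -/

import Mathlib

attribute [local instance] LieRing.ofAssociativeRing

noncomputable section

namespace JordanSL

section JordanBlocks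

variable {K W : Type*} [Field K] [AddCommGroup W] [Module K W]

/-- `W ↓ K[f] = J_{d 0}(μ) ⊕ ⋯ ⊕ J_{d (t-1)}(μ)`: all `d i` are positive and there is a basis
`b ⟨i, j⟩` (`i < t`, `j < d i`) of `W` with `f b⟨i, 0⟩ = μ b⟨i, 0⟩` and
`f b⟨i, j⟩ = μ b⟨i, j⟩ + b⟨i, j - 1⟩` for `j > 0`. -/
def HasJordanBlocks (f : Module.End K W) (μ : K) {t : ℕ} (d : Fin t → ℕ) : Prop :=
  (∀ i, 1 ≤ d i) ∧
  ∃ b : Module.Basis (Σ i : Fin t, Fin (d i)) K W,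
    ∀ (i : Fin t) (j : Fin (d i)),
      f (b ⟨i, j⟩) = μ • b ⟨i, j⟩ +
        (if (j : ℕ) = 0 then 0 else b ⟨i, ⟨(j : ℕ) - 1, lt_of_le_of_lt (Nat.sub_le _ _) j.2⟩⟩)

/-- The unipotent linear map `x` (eigenvalue `1`) and the nilpotent linear map `y` (eigenvalue `0`)
have the same Jordan block sizes, with multiplicities. -/
def SameJordanBlockSizes (x y : Module.End K W) : Prop :=
  ∃ (t : ℕ) (d : Fin t → ℕ), HasJordanBlocks x 1 d ∧ HasJordanBlocks y 0 d

end JordanBlocks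

section LieAlgebras

variable (K V : Type*) [Field K] [AddCommGroup V] [Module K V]

/-- `𝔰𝔩(V)`, the Lie algebra of trace-zero endomorphisms of `V`. -/
def sl : LieSubalgebra K (Module.End K V) where
  __ := LinearMap.ker (LinearMap.trace K V)
  lie_mem' := by
    intro x y _ _
    change LinearMap.trace K V ⁅x, y⁆ = 0
    rw [Ring.lie_def, map_sub, LinearMap.trace_mul_comm, sub_self]

/-- `𝔭𝔰𝔩(V) = 𝔰𝔩(V) / Z(𝔰𝔩(V))`. -/
abbrev psl : Type _ := sl K V ⧸ LieAlgebra.center K (sl K V)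

/-- The natural representation of `SL(V)` on `V`. -/
def natRep : Representation K (SpecialLinearGroup K V) V where
  toFun g := (g : V →ₗ[K] V)
  map_one' := rfl
  map_mul' _ _ := rfl

/-- The action `g • x = g x g⁻¹` of `SL(V)` on `𝔤𝔩(V) = End(V)`. -/
def glRep : Representation K (SpecialLinearGroup K V) (Module.End K V) :=
  (natRep K V).linHom (natRep K V)

variable {K V}

theorem glRep_apply (g : SpecialLinearGroup K V) (x : Module.End K V) :
    glRep K V g x = natRep K V g * x * natRep K V g⁻¹ := rfl

theorem natRep_inv_mul (g : SpecialLinearGroup K V) : natRep K V g⁻¹ * natRep K V g = 1 := by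
  rw [← map_mul, inv_mul_cancel, map_one]

theorem glRep_mem_sl (g : SpecialLinearGroup K V) {x : Module.End K V} (hx : x ∈ sl K V) :
    glRep K V g x ∈ sl K V := by
  change LinearMap.trace K V _ = 0
  rw [glRep_apply, LinearMap.trace_mul_comm, ← mul_assoc, natRep_inv_mul, one_mul]
  exact hx

variable (K V) in
/-- The action of `SL(V)` on `𝔰𝔩(V)` by conjugation. -/
def slRep : Representation K (SpecialLinearGroup K V) (sl K V) where
  toFun g :=
    { toFun := fun x => ⟨glRep K V g x, glRep_mem_sl g x.2⟩
      map_add' := fun x y => Subtype.ext (map_add (glRep K V g) (x : Module.End K V) y)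
      map_smul' := fun c x => Subtype.ext (map_smul (glRep K V g) c (x : Module.End K V)) }
  map_one' := by
    ext1 x
    apply Subtype.ext
    change glRep K V 1 x = x
    rw [map_one]; rfl
  map_mul' g h := by
    ext1 x
    apply Subtype.ext
    change glRep K V (g * h) x = glRep K V g (glRep K V h x)
    rw [map_mul]; rfl

theorem slRep_lie (g : SpecialLinearGroup K V) (x y : sl K V) :
    slRep K V g ⁅x, y⁆ = ⁅slRep K V g x, slRep K V g y⁆ := by
  apply Subtype.ext
  change glRep K V g ⁅(x : Module.End K V), (y : Module.End K V)⁆ =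
    ⁅glRep K V g x, glRep K V g y⁆
  have h (a b : Module.End K V) : glRep K V g (a * b) = glRep K V g a * glRep K V g b := by
    simp only [glRep_apply, mul_assoc]
    rw [← mul_assoc (natRep K V g⁻¹) (natRep K V g), natRep_inv_mul, one_mul]
  rw [Ring.lie_def, Ring.lie_def, map_sub, h, h]

theorem slRep_mem_center (g : SpecialLinearGroup K V) {x : sl K V}
    (hx : x ∈ LieAlgebra.center K (sl K V)) : slRep K V g x ∈ LieAlgebra.center K (sl K V) := by
  rw [LieModule.mem_maxTrivSubmodule] at hx ⊢
  intro y
  have h : slRep K V g (slRep K V g⁻¹ y) = y := by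
    rw [← Module.End.mul_apply, ← map_mul, mul_inv_cancel, map_one]; rfl
  rw [← h, ← slRep_lie, hx, map_zero]

variable (K V) in
/-- The action of `SL(V)` on `𝔭𝔰𝔩(V)` induced by conjugation. -/
def pslRep : Representation K (SpecialLinearGroup K V) (psl K V) where
  toFun g := Submodule.mapQ (LieAlgebra.center K (sl K V)).toSubmodule
    (LieAlgebra.center K (sl K V)).toSubmodule (slRep K V g) (fun _ hx => slRep_mem_center g hx)
  map_one' := by
    apply LinearMap.ext
    rintro ⟨x⟩
    change Submodule.Quotient.mk (slRep K V 1 x) = Submodule.Quotient.mk x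
    rw [map_one]; rfl
  map_mul' g h := by
    apply LinearMap.ext
    rintro ⟨x⟩
    change Submodule.Quotient.mk (slRep K V (g * h) x) =
      Submodule.Quotient.mk (slRep K V g (slRep K V h x))
    rw [map_mul]; rfl

/-- The action of `e ∈ 𝔰𝔩(V)` on `𝔤𝔩(V)`, `x ↦ [e, x]`. -/
def glAct (e : sl K V) : Module.End K (Module.End K V) :=
  LieAlgebra.ad K (Module.End K V) (e : Module.End K V)

/-- The action of `e ∈ 𝔰𝔩(V)` on `𝔰𝔩(V)`, `x ↦ [e, x]`. -/
def slAct (e : sl K V) : Module.End K (sl K V) :=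
  LieAlgebra.ad K (sl K V) e

/-- The action of `e ∈ 𝔰𝔩(V)` on `𝔭𝔰𝔩(V)` induced by `x ↦ [e, x]`. -/
def pslAct (e : sl K V) : Module.End K (psl K V) :=
  LieModule.toEnd K (sl K V) (psl K V) e

end LieAlgebras

section RationalRepresentations

variable (K V : Type*) [Field K] [AddCommGroup V] [Module K V]

/-- The algebra `K[G]` of regular functions on the algebraic group `G = SL(V)`: the algebra of
functions on `G` generated by the matrix coefficients `g ↦ φ (g v)` of the natural module. -/
def regularFunctions : Subalgebra K (SpecialLinearGroup K V → K) :=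
  Algebra.adjoin K {f | ∃ (φ : Module.Dual K V) (v : V), f = fun g => φ (natRep K V g v)}

variable {K V}
variable {W : Type*} [AddCommGroup W] [Module K W]

/-- A representation of `G = SL(V)` is rational if `W` is finite-dimensional and all its matrix
coefficients are regular functions on `G`. -/
def IsRational (ρ : Representation K (SpecialLinearGroup K V) W) : Prop :=
  FiniteDimensional K W ∧
    ∀ (ψ : Module.Dual K W) (w : W), (fun g => ψ (ρ g w)) ∈ regularFunctions K V

/-- `δ` is a tangent vector of `G = SL(V)` at the identity, i.e. a point derivation `K[G] → K`
at `1`. -/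
def IsTangentVector (δ : regularFunctions K V →ₗ[K] K) : Prop :=
  ∀ a b : regularFunctions K V, δ (a * b) = a.1 1 * δ b + b.1 1 * δ a

/-- `D` is the value of the differential of `ρ` at the tangent vector `δ`. -/
def IsDifferentialAt (ρ : Representation K (SpecialLinearGroup K V) W)
    (δ : regularFunctions K V →ₗ[K] K) (D : Module.End K W) : Prop :=
  ∀ (ψ : Module.Dual K W) (w : W),
    ∃ h : (fun g => ψ (ρ g w)) ∈ regularFunctions K V, ψ (D w) = δ ⟨_, h⟩

/-- `D = dρ(e)` for `e ∈ 𝔰𝔩(V)`. Here `𝔰𝔩(V)` is identified with the Lie algebra of `G = SL(V)`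
in the usual way: `e` corresponds to the tangent vector at the identity at which the differential
of the natural representation is `e`. -/
def IsDifferential (ρ : Representation K (SpecialLinearGroup K V) W) (e : sl K V)
    (D : Module.End K W) : Prop :=
  ∃ δ : regularFunctions K V →ₗ[K] K, IsTangentVector δ ∧
    IsDifferentialAt (natRep K V) δ (e : Module.End K V) ∧ IsDifferentialAt ρ δ D

variable {n : ℕ}

/-- `g` is the element `diag(s 0, …, s (n-1))`, with respect to the basis `b`, of the diagonal
maximal torus. -/
def IsDiagonal (b : Module.Basis (Fin n) K V) (g : SpecialLinearGroup K V) (s : Fin n → K) : Prop :=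
  ∀ i, g (b i) = s i • b i

/-- `g` is upper unitriangular with respect to the basis `b`. -/
def IsUpperUnitriangular (b : Module.Basis (Fin n) K V) (g : SpecialLinearGroup K V) : Prop :=
  ∀ i, g (b i) - b i ∈ Submodule.span K (b '' {j | j < i})

/-- The value `s 0 ⋯ s (i-1)` of the fundamental dominant weight `ϖ_i` (`1 ≤ i ≤ n - 1`) at
`diag(s 0, …, s (n-1))`. -/
def fundamentalWeight (i : ℕ) (s : Fin n → K) : K :=
  ∏ j ∈ Finset.univ.filter (fun j : Fin n => (j : ℕ) < i), s j

/-- `(W, ρ)` is a rational irreducible representation of `SL(V)` with highest weight `χ`, with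
respect to the maximal torus of diagonal and the Borel subgroup of upper triangular elements in the
basis `b`: it has a nonzero vector that is fixed by the unipotent radical of the Borel subgroup
and on which the torus acts by `χ`. -/
def IsIrreducibleOfHighestWeight (b : Module.Basis (Fin n) K V) (χ : (Fin n → K) → K)
    (ρ : Representation K (SpecialLinearGroup K V) W) : Prop :=
  IsRational ρ ∧ ρ.IsIrreducible ∧
    ∃ w : W, w ≠ 0 ∧ (∀ g, IsUpperUnitriangular b g → ρ g w = w) ∧
      ∀ g s, IsDiagonal b g s → ρ g w = χ s • w

/-- `(W, ρ)` is `L_G(ϖ_1 + ϖ_{n-1})` for `G = SL(V)`, `n = dim V`. -/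
def IsAdjointSimple (b : Module.Basis (Fin n) K V)
    (ρ : Representation K (SpecialLinearGroup K V) W) : Prop :=
  IsIrreducibleOfHighestWeight b
    (fun s => fundamentalWeight 1 s * fundamentalWeight (n - 1) s) ρ

end RationalRepresentations

end JordanSL

end

/-! After conjugating `u` inside SL(V) one may take `u = 1 + e`. Then (Ad u − 1)x = (ux − xu)u⁻¹ =
[e, x]u⁻¹, and right multiplication by u⁻¹ commutes with ad e, so (Ad u − 1)^k x = (ad e)^k(x)
u^{-k} (`glRep_sub_one_pow_apply`). The two maps have equal kernels for every k, on 𝔤𝔩(V) and on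
𝔰𝔩(V). Kernel dimensions of powers determine block sizes (`sameJordanBlockSizes_iff`), which gives
(i).

On 𝔭𝔰𝔩(V) the kernels also depend on how the images on 𝔰𝔩(V) meet the centre. If p ∤ n the centre is
zero. If p ∣ n it is the line of scalars, and the question is whether, for each k, (ad e)^k reaches
1 from 𝔰𝔩(V) exactly when it reaches u^k. Put q = p^α. For k < q, divided-power operators X_k
satisfy (ad e)^k X_k = 1 (`glAct_pow_dividedPower`). If k < q − 1, then [e, X_{k+1}] is a traceless
preimage of 1, and [e, X_{k+1}u^k] is one of u^k. If k ≥ q, neither is reached, even from 𝔤𝔩(V): ad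
e is skew for the trace form, and a projection z with (ad e)^q z = 0 and tr z ≠ 0 obstructs it. If k
= q − 1, then 1 is reached by the traceless X_k, while all preimages of u^k have the same trace
tr(X_k u^k) = Σ C(d_i, q) ≡ n/q mod p. Hence the condition p^{α+1} ∣ n.

To identify 𝔭𝔰𝔩(V) with L(ϖ_1 + ϖ_{n−1}): it is rational, irreducible by a transvection argument
(`mem_of_transvection_stable`), and has the class of E_{1,n} as highest weight vector. Highest
weights determine rational irreducibles (`exists_equiv_of_isIrreducibleOfHighestWeight`), by density
of the big cell and contraction of lower unitriangular elements by a torus. The differential is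
computed along the curve 1 + re. -/

namespace JordanSL

/-! ### Jordan block sizes and ranks of powers. -/

section JordanBlocks

open Module Polynomial

variable {K W W' : Type*} [Field K] [AddCommGroup W] [Module K W] [AddCommGroup W'] [Module K W']

theorem HasJordanBlocks.conj {f : End K W} {g : End K W'} {μ : K} {t : ℕ} {d : Fin t → ℕ}
    (h : HasJordanBlocks f μ d) (φ : W ≃ₗ[K] W') (hφ : ∀ w, φ (f w) = g (φ w)) :
    HasJordanBlocks g μ d := by
  obtain ⟨hd, b, hb⟩ := h
  refine ⟨hd, b.map φ, fun i j => ?_⟩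
  simp only [Basis.map_apply, ← hφ, hb]
  split_ifs <;> simp

theorem SameJordanBlockSizes.conj {x y : End K W} {x' y' : End K W'}
    (h : SameJordanBlockSizes x y) (φ ψ : W ≃ₗ[K] W') (hx : ∀ w, φ (x w) = x' (φ w))
    (hy : ∀ w, ψ (y w) = y' (ψ w)) : SameJordanBlockSizes x' y' := by
  obtain ⟨t, d, h1, h2⟩ := h
  exact ⟨t, d, h1.conj φ hx, h2.conj ψ hy⟩

theorem hasJordanBlocks_one_iff {f : End K W} {t : ℕ} {d : Fin t → ℕ} :
    HasJordanBlocks f 1 d ↔ HasJordanBlocks (f - 1) 0 d := by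
  refine and_congr Iff.rfl (exists_congr fun b => forall₂_congr fun i j => ?_)
  rw [LinearMap.sub_apply, End.one_apply, one_smul, zero_smul, zero_add, sub_eq_iff_eq_add']

/-- Reindexing a basis of Jordan chains. -/
theorem HasJordanBlocks.of_chains {f : End K W} {ι : Type*} (d : ι → ℕ)
    (b : Basis (Σ i, Fin (d i)) K W)
    (hb : ∀ (i : ι) (j : Fin (d i)), f (b ⟨i, j⟩) =
      if (j : ℕ) = 0 then 0 else b ⟨i, ⟨(j : ℕ) - 1, lt_of_le_of_lt (Nat.sub_le _ _) j.2⟩⟩)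
    {t : ℕ} (σ : Fin t ≃ {i // 1 ≤ d i}) : HasJordanBlocks f 0 (fun s => d (σ s)) := by
  let F : (Σ s : Fin t, Fin (d (σ s))) → Σ i, Fin (d i) := fun x => ⟨σ x.1, x.2⟩
  have hF : Function.Bijective F := by
    constructor
    · rintro ⟨s, j⟩ ⟨s', j'⟩ h
      have h1 : s = s' := σ.injective (Subtype.ext (congrArg Sigma.fst h))
      subst h1
      simpa [F] using h
    · rintro ⟨i, j⟩
      obtain ⟨s, hs⟩ := σ.surjective ⟨i, by have := j.2; omega⟩
      have hs' : ((σ s : {i // 1 ≤ d i}) : ι) = i := congrArg Subtype.val hs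
      subst hs'
      exact ⟨⟨s, j⟩, rfl⟩
  refine ⟨fun s => (σ s).2, b.reindex (Equiv.ofBijective F hF).symm, fun i j => ?_⟩
  simp only [Basis.reindex_apply, Equiv.symm_symm, Equiv.ofBijective_apply, F, hb, zero_smul,
    zero_add]

/-- With X acting as `f`, `W` is an X-power torsion K[X]-module, hence a direct sum of modules
K[X]/(X^{k_i}). -/
theorem exists_hasJordanBlocks [FiniteDimensional K W] {f : End K W} (hf : IsNilpotent f) :
    ∃ (t : ℕ) (d : Fin t → ℕ), HasJordanBlocks f 0 d := by
  have htors : Module.IsTorsion' (AEval' f) (Submonoid.powers (X : K[X])) := by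
    obtain ⟨N, hN⟩ := hf
    intro w
    refine ⟨⟨X ^ N, N, rfl⟩, ?_⟩
    obtain ⟨v, rfl⟩ := (AEval'.of f).surjective w
    change (X ^ N : K[X]) • AEval'.of f v = 0
    rw [AEval'.X_pow_smul_of, hN]
    simp
  obtain ⟨m, k, ⟨φ⟩⟩ := torsion_by_prime_power_decomposition (irreducible_X (R := K)) htors
  have hmon (i : Fin m) : (X ^ k i : K[X]).Monic := monic_X_pow _
  have hdeg (i : Fin m) : (X ^ k i : K[X]).natDegree = k i := natDegree_X_pow _
  -- The powers of X are listed in reverse, so that multiplication by X lowers the index.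
  let c (i : Fin m) : Basis (Fin (k i)) K (K[X] ⧸ Submodule.span K[X] {(X : K[X]) ^ k i}) :=
    (AdjoinRoot.powerBasisAux' (hmon i)).reindex ((finCongr (hdeg i)).trans Fin.revPerm)
  have hc (i : Fin m) (j : Fin (k i)) :
      c i j = Submodule.Quotient.mk ((X : K[X]) ^ (k i - 1 - (j : ℕ))) := by
    have := (AdjoinRoot.powerBasis' (hmon i)).basis_eq_pow
      ((finCongr (hdeg i)).symm (Fin.revPerm.symm j))
    change (AdjoinRoot.powerBasisAux' (hmon i)) _ = _ at this
    refine (Basis.reindex_apply (AdjoinRoot.powerBasisAux' (hmon i))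
      ((finCongr (hdeg i)).trans Fin.revPerm) j).trans (this.trans ?_)
    change AdjoinRoot.root _ ^ _ = AdjoinRoot.mk _ _
    rw [map_pow, AdjoinRoot.mk_X]
    congr 1
    simp [Fin.rev]
    omega
  let b : Basis (Σ i : Fin m, Fin (k i)) K W :=
    (DFinsupp.basis c).map ((AEval'.of f).trans (φ.restrictScalars K)).symm
  have hb (i : Fin m) (j : Fin (k i)) : φ (AEval'.of f (b ⟨i, j⟩)) =
      DirectSum.lof K[X] (Fin m) (fun i => K[X] ⧸ Submodule.span K[X] {(X : K[X]) ^ k i}) i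
        (c i j) := by
    have : φ (AEval'.of f (b ⟨i, j⟩)) = DFinsupp.basis c ⟨i, j⟩ := by
      simp only [b, Basis.map_apply]
      exact LinearEquiv.apply_symm_apply ((AEval'.of f).trans (φ.restrictScalars K)) _
    rw [this]
    apply (DFinsupp.basis c).repr.injective
    rw [Basis.repr_self]
    ext ⟨i', j'⟩
    change _ = (c i').repr (DirectSum.lof K[X] (Fin m)
      (fun i => K[X] ⧸ Submodule.span K[X] {(X : K[X]) ^ k i}) i (c i j) i') j'
    by_cases h : i = i'
    · subst h
      rw [DirectSum.lof_apply, Basis.repr_self]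
      simp [Finsupp.single_apply]
    · rw [DirectSum.lof_eq_of, DirectSum.of_eq_of_ne _ _ _ (Ne.symm h)]
      simp [h]
  -- Exponents k_i = 0 may occur; these zero summands are discarded.
  refine ⟨Fintype.card {i // 1 ≤ k i}, _, HasJordanBlocks.of_chains k b (fun i j => ?_)
    (Fintype.equivFin _).symm⟩
  apply (AEval'.of f).injective
  apply φ.injective
  rw [← AEval'.X_smul_of, map_smul, hb, ← map_smul, hc, ← Submodule.Quotient.mk_smul]
  split_ifs with hj
  · have : (Submodule.Quotient.mk ((X : K[X]) • X ^ (k i - 1 - (j : ℕ))) :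
        K[X] ⧸ Submodule.span K[X] {(X : K[X]) ^ k i}) = 0 := by
      rw [Submodule.Quotient.mk_eq_zero, smul_eq_mul, ← pow_succ']
      rw [hj, show k i - 1 - 0 + 1 = k i by have := j.2; omega]
      exact Submodule.mem_span_singleton_self _
    rw [this]
    simp
  · rw [hb, hc, smul_eq_mul, ← pow_succ']
    congr 4
    have := j.2
    simp only
    omega

theorem HasJordanBlocks.pow_apply {f : End K W} {t : ℕ} {d : Fin t → ℕ}
    {b : Basis (Σ i : Fin t, Fin (d i)) K W}
    (hb : ∀ (i : Fin t) (j : Fin (d i)), f (b ⟨i, j⟩) = (0 : K) • b ⟨i, j⟩ +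
      (if (j : ℕ) = 0 then 0 else b ⟨i, ⟨(j : ℕ) - 1, lt_of_le_of_lt (Nat.sub_le _ _) j.2⟩⟩))
    (k : ℕ) (i : Fin t) (j : Fin (d i)) : (f ^ k) (b ⟨i, j⟩) =
      if (j : ℕ) < k then 0 else b ⟨i, ⟨(j : ℕ) - k, lt_of_le_of_lt (Nat.sub_le _ _) j.2⟩⟩ := by
  induction k with
  | zero => simp
  | succ k ih =>
    rw [pow_succ', End.mul_apply, ih]
    by_cases h : (j : ℕ) < k
    · rw [if_pos h, if_pos (by omega), map_zero]
    · rw [if_neg h, hb, zero_smul, zero_add]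
      by_cases h' : (j : ℕ) - k = 0
      · rw [if_pos h', if_pos (by omega)]
      · rw [if_neg h', if_neg (by omega)]
        rfl

/-- `f ^ k` shifts each chain down by k, so its image is spanned by the first d_i − k vectors of the
chains (truncated subtraction). -/
theorem HasJordanBlocks.finrank_range_pow {f : End K W} {t : ℕ} {d : Fin t → ℕ}
    (h : HasJordanBlocks f 0 d) (k : ℕ) :
    finrank K (LinearMap.range (f ^ k)) = ∑ i, (d i - k) := by
  obtain ⟨-, b, hb⟩ := h
  let F : (Σ i : Fin t, Fin (d i - k)) → Σ i : Fin t, Fin (d i) :=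
    fun x => ⟨x.1, ⟨x.2, lt_of_lt_of_le x.2.2 (Nat.sub_le _ _)⟩⟩
  have hF : Function.Injective F := by
    rintro ⟨i, j⟩ ⟨i', j'⟩ h
    have h1 : i = i' := congrArg Sigma.fst h
    subst h1
    simpa [F, Fin.ext_iff] using h
  have hr : LinearMap.range (f ^ k) = Submodule.span K (Set.range (b ∘ F)) := by
    rw [LinearMap.range_eq_map, ← b.span_eq, Submodule.map_span]
    apply le_antisymm <;> rw [Submodule.span_le]
    · rintro _ ⟨_, ⟨⟨i, j⟩, rfl⟩, rfl⟩
      rw [HasJordanBlocks.pow_apply hb]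
      split_ifs with hj
      · exact zero_mem _
      · exact Submodule.subset_span ⟨⟨i, ⟨j - k, by have := j.2; omega⟩⟩, rfl⟩
    · rintro _ ⟨⟨i, j⟩, rfl⟩
      refine Submodule.subset_span ⟨b ⟨i, ⟨j + k, by have := j.2; omega⟩⟩, ⟨_, rfl⟩, ?_⟩
      rw [HasJordanBlocks.pow_apply hb, if_neg (by simp)]
      simp [F]
  rw [hr, finrank_span_eq_card (b.linearIndependent.comp F hF)]
  simp

/-- The second difference of k ↦ Σ (d_i − k) counts the blocks of size k + 1, so these sums recover
the multiset of sizes. -/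
theorem exists_equiv_of_sum_sub_eq {t t' : ℕ} (d : Fin t → ℕ) (d' : Fin t' → ℕ)
    (hd : ∀ i, 1 ≤ d i) (hd' : ∀ i, 1 ≤ d' i)
    (h : ∀ k, ∑ i, (d i - k) = ∑ i, (d' i - k)) : ∃ σ : Fin t' ≃ Fin t, ∀ i, d (σ i) = d' i := by
  have key (t : ℕ) (d : Fin t → ℕ) (k : ℕ) :
      ∑ i, (d i - k) + ∑ i, (d i - (k + 2)) =
        2 * ∑ i, (d i - (k + 1)) + Fintype.card {i // d i = k + 1} := by
    rw [Fintype.card_subtype, Finset.card_filter, Finset.mul_sum, ← Finset.sum_add_distrib,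
      ← Finset.sum_add_distrib]
    refine Finset.sum_congr rfl fun i _ => ?_
    split_ifs <;> omega
  have hcard (k : ℕ) : Fintype.card {i // d' i = k} = Fintype.card {i // d i = k} := by
    cases k with
    | zero =>
      have := Subtype.isEmpty_of_false fun i (hi : d i = 0) => by have := hd i; omega
      have := Subtype.isEmpty_of_false fun i (hi : d' i = 0) => by have := hd' i; omega
      simp only [Fintype.card_eq_zero]
    | succ k =>
      have h1 := key t d k
      have h2 := key t' d' k
      simp only [h] at h1
      omega
  let σ : Fin t' ≃ Fin t := (Equiv.sigmaFiberEquiv d').symm.trans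
    ((Equiv.sigmaCongrRight fun k => Fintype.equivOfCardEq (hcard k)).trans
      (Equiv.sigmaFiberEquiv d))
  exact ⟨σ, fun i => (Fintype.equivOfCardEq (hcard (d' i)) ⟨i, rfl⟩).2⟩

theorem HasJordanBlocks.of_finrank_range_pow_eq {f : End K W} {g : End K W'} {t t' : ℕ}
    {d : Fin t → ℕ} {d' : Fin t' → ℕ} (hf : HasJordanBlocks f 0 d) (hg : HasJordanBlocks g 0 d')
    (h : ∀ k, finrank K (LinearMap.range (f ^ k)) = finrank K (LinearMap.range (g ^ k))) :
    HasJordanBlocks g 0 d := by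
  have hsum (k : ℕ) : ∑ i, (d i - k) = ∑ i, (d' i - k) := by
    rw [← hf.finrank_range_pow, ← hg.finrank_range_pow, h]
  obtain ⟨σ, hσ⟩ := exists_equiv_of_sum_sub_eq d' d hg.1 hf.1 fun k => (hsum k).symm
  obtain rfl : d = fun i => d' (σ i) := funext fun i => (hσ i).symm
  obtain ⟨hd, b, hb⟩ := hg
  refine HasJordanBlocks.of_chains d' b (fun i j => by simp [hb])
    (σ.trans (Equiv.subtypeUnivEquiv hd).symm)

/-- The Jordan block sizes of nilpotent maps are the same if and only if the dimensions of the
kernels of their powers are. -/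
theorem sameJordanBlockSizes_iff [FiniteDimensional K W] {x y : End K W}
    (hx : IsNilpotent (x - 1)) (hy : IsNilpotent y) :
    SameJordanBlockSizes x y ↔ ∀ k, finrank K (LinearMap.ker ((x - 1) ^ k)) =
      finrank K (LinearMap.ker (y ^ k)) := by
  have hk (k : ℕ) : finrank K (LinearMap.ker ((x - 1) ^ k)) = finrank K (LinearMap.ker (y ^ k)) ↔
      finrank K (LinearMap.range ((x - 1) ^ k)) = finrank K (LinearMap.range (y ^ k)) := by
    have h1 := LinearMap.finrank_range_add_finrank_ker ((x - 1) ^ k)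
    have h2 := LinearMap.finrank_range_add_finrank_ker (y ^ k)
    omega
  simp only [hk]
  constructor
  · rintro ⟨t, d, h1, h2⟩ k
    rw [(hasJordanBlocks_one_iff.1 h1).finrank_range_pow, h2.finrank_range_pow]
  · intro h
    obtain ⟨t, d, h1⟩ := exists_hasJordanBlocks hx
    obtain ⟨t', d', h2⟩ := exists_hasJordanBlocks hy
    exact ⟨t, d, hasJordanBlocks_one_iff.2 h1, h1.of_finrank_range_pow_eq h2 h⟩

theorem HasJordanBlocks.isNilpotent {f : End K W} {t : ℕ} {d : Fin t → ℕ}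
    (h : HasJordanBlocks f 0 d) : IsNilpotent f := by
  obtain ⟨-, b, hb⟩ := h
  refine ⟨∑ i, d i, b.ext fun ⟨i, j⟩ => ?_⟩
  rw [HasJordanBlocks.pow_apply hb, if_pos, LinearMap.zero_apply]
  exact j.2.trans_le (Finset.single_le_sum (fun _ _ => Nat.zero_le _) (Finset.mem_univ i))

end JordanBlocks

end JordanSL

namespace JordanSL

/-! ### Comparison of the powers of Ad u − 1 and of ad e. -/

section Kernels

open Module

variable {K V : Type*} [Field K] [AddCommGroup V] [Module K V]

theorem glAct_apply (e : sl K V) (x : End K V) :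
    glAct e x = (e : End K V) * x - x * (e : End K V) := rfl

theorem coe_slAct_pow (e : sl K V) (k : ℕ) (x : sl K V) :
    (((slAct e ^ k) x : sl K V) : End K V) = (glAct e ^ k) (x : End K V) := by
  induction k generalizing x with
  | zero => rfl
  | succ k ih => rw [pow_succ, End.mul_apply, ih, pow_succ, End.mul_apply]; rfl

theorem coe_slRep_sub_one_pow (u : SpecialLinearGroup K V) (k : ℕ) (x : sl K V) :
    ((((slRep K V u - 1) ^ k) x : sl K V) : End K V) = ((glRep K V u - 1) ^ k) (x : End K V) := by
  induction k generalizing x with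
  | zero => rfl
  | succ k ih => rw [pow_succ, End.mul_apply, ih, pow_succ, End.mul_apply]; rfl

theorem pslAct_pow_mk (e : sl K V) (k : ℕ) (x : sl K V) :
    (pslAct e ^ k) (Submodule.Quotient.mk x) = Submodule.Quotient.mk ((slAct e ^ k) x) := by
  induction k generalizing x with
  | zero => rfl
  | succ k ih => rw [pow_succ, End.mul_apply, pow_succ, End.mul_apply, ← ih]; rfl

theorem pslRep_sub_one_pow_mk (u : SpecialLinearGroup K V) (k : ℕ) (x : sl K V) :
    ((pslRep K V u - 1) ^ k) (Submodule.Quotient.mk x) =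
      Submodule.Quotient.mk (((slRep K V u - 1) ^ k) x) := by
  induction k generalizing x with
  | zero => rfl
  | succ k ih => rw [pow_succ, End.mul_apply, pow_succ, End.mul_apply, ← ih]; rfl

theorem natRep_mul_inv (g : SpecialLinearGroup K V) : natRep K V g * natRep K V g⁻¹ = 1 := by
  rw [← map_mul, mul_inv_cancel, map_one]

theorem glAct_pow_mul_of_commute {e : sl K V} {z : End K V} (h : Commute z (e : End K V)) (k : ℕ)
    (x : End K V) : (glAct e ^ k) (x * z) = (glAct e ^ k) x * z := by
  induction k with
  | zero => rfl
  | succ k ih =>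
    rw [pow_succ', End.mul_apply, ih, End.mul_apply, glAct_apply, glAct_apply, sub_mul, mul_assoc,
      mul_assoc, mul_assoc, h.eq]

section

variable {e : sl K V} {u : SpecialLinearGroup K V} (hu : natRep K V u = 1 + (e : End K V))
include hu

theorem commute_natRep : Commute (natRep K V u) (e : End K V) := by
  rw [hu]
  exact (Commute.one_left _).add_left (Commute.refl _)

theorem commute_natRep_inv : Commute (natRep K V u⁻¹) (e : End K V) := by
  have h := (commute_natRep hu).eq
  change _ = _
  calc natRep K V u⁻¹ * (e : End K V)
      = natRep K V u⁻¹ * ((e : End K V) * natRep K V u) * natRep K V u⁻¹ := by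
        rw [mul_assoc, mul_assoc, natRep_mul_inv, mul_one]
    _ = e * natRep K V u⁻¹ := by rw [← h, ← mul_assoc, natRep_inv_mul, one_mul]

/-- One factor is uxu⁻¹ − x = (ux − xu)u⁻¹ = [e, x]u⁻¹; the factors u⁻¹ then move to the right,
since u⁻¹ commutes with e. -/
theorem glRep_sub_one_pow_apply (k : ℕ) (x : End K V) :
    ((glRep K V u - 1) ^ k) x = (glAct e ^ k) x * natRep K V u⁻¹ ^ k := by
  have h1 (x : End K V) : (glRep K V u - 1) x = glAct e (x * natRep K V u⁻¹) := by
    have := glAct_pow_mul_of_commute (commute_natRep_inv hu) 1 x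
    rw [pow_one] at this
    rw [this, LinearMap.sub_apply, End.one_apply, glRep_apply, glAct_apply]
    have h2 : x = x * natRep K V u * natRep K V u⁻¹ := by rw [mul_assoc, natRep_mul_inv, mul_one]
    nth_rewrite 2 [h2]
    rw [hu]
    noncomm_ring
  induction k generalizing x with
  | zero => simp
  | succ k ih =>
    rw [pow_succ, End.mul_apply, h1, ih, ← End.mul_apply, ← pow_succ,
      glAct_pow_mul_of_commute (commute_natRep_inv hu), mul_assoc, ← pow_succ']

theorem glRep_sub_one_pow_apply_eq_iff (k : ℕ) (x y : End K V) :
    ((glRep K V u - 1) ^ k) x = y ↔ (glAct e ^ k) x = y * natRep K V u ^ k := by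
  have hc : Commute (natRep K V u) (natRep K V u⁻¹) := by
    change _ = _
    rw [natRep_inv_mul, natRep_mul_inv]
  have h1 : natRep K V u ^ k * natRep K V u⁻¹ ^ k = 1 := by
    rw [← hc.mul_pow, natRep_mul_inv, one_pow]
  have h2 : natRep K V u⁻¹ ^ k * natRep K V u ^ k = 1 := by
    rw [← hc.symm.mul_pow, natRep_inv_mul, one_pow]
  rw [glRep_sub_one_pow_apply hu]
  constructor
  · rintro rfl
    rw [mul_assoc, h2, mul_one]
  · intro h
    rw [h, mul_assoc, h1, mul_one]

theorem ker_glRep_sub_one_pow (k : ℕ) :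
    LinearMap.ker ((glRep K V u - 1) ^ k) = LinearMap.ker (glAct e ^ k) := by
  ext x
  rw [LinearMap.mem_ker, LinearMap.mem_ker, glRep_sub_one_pow_apply_eq_iff hu, zero_mul]

theorem ker_slRep_sub_one_pow (k : ℕ) :
    LinearMap.ker ((slRep K V u - 1) ^ k) = LinearMap.ker (slAct e ^ k) := by
  ext x
  rw [LinearMap.mem_ker, LinearMap.mem_ker, ← Subtype.coe_inj, ← Subtype.coe_inj,
    coe_slRep_sub_one_pow, coe_slAct_pow]
  exact (SetLike.ext_iff (A := Submodule K (End K V))).1 (ker_glRep_sub_one_pow hu k) (x : End K V)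

end

theorem isNilpotent_glAct {e : sl K V} (he : IsNilpotent (e : End K V)) :
    IsNilpotent (glAct e) :=
  LieAlgebra.ad_nilpotent_of_nilpotent he

theorem isNilpotent_slAct {e : sl K V} (he : IsNilpotent (e : End K V)) :
    IsNilpotent (slAct e) := by
  obtain ⟨k, hk⟩ := isNilpotent_glAct he
  refine ⟨k, LinearMap.ext fun x => Subtype.ext ?_⟩
  rw [coe_slAct_pow, hk]
  rfl

theorem isNilpotent_pslAct {e : sl K V} (he : IsNilpotent (e : End K V)) :
    IsNilpotent (pslAct e) := by
  obtain ⟨k, hk⟩ := isNilpotent_slAct he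
  refine ⟨k, LinearMap.ext ?_⟩
  rintro ⟨x⟩
  refine (pslAct_pow_mk e k x).trans ?_
  rw [hk]
  rfl

theorem isNilpotent_of_ker_pow_eq {W : Type*} [AddCommGroup W] [Module K W] {f g : End K W}
    (h : ∀ k, LinearMap.ker (f ^ k) = LinearMap.ker (g ^ k)) (hg : IsNilpotent g) :
    IsNilpotent f := by
  obtain ⟨k, hk⟩ := hg
  exact ⟨k, LinearMap.ker_eq_top.1 (by rw [h, hk, LinearMap.ker_zero])⟩

theorem isNilpotent_slRep_sub_one {e : sl K V} {u : SpecialLinearGroup K V}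
    (hu : natRep K V u = 1 + (e : End K V)) (he : IsNilpotent (e : End K V)) :
    IsNilpotent (slRep K V u - 1) :=
  isNilpotent_of_ker_pow_eq (ker_slRep_sub_one_pow hu) (isNilpotent_slAct he)

theorem isNilpotent_pslRep_sub_one {e : sl K V} {u : SpecialLinearGroup K V}
    (hu : natRep K V u = 1 + (e : End K V)) (he : IsNilpotent (e : End K V)) :
    IsNilpotent (pslRep K V u - 1) := by
  obtain ⟨k, hk⟩ := isNilpotent_slRep_sub_one hu he
  refine ⟨k, LinearMap.ext ?_⟩
  rintro ⟨x⟩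
  refine (pslRep_sub_one_pow_mk u k x).trans ?_
  rw [hk]
  rfl

theorem finrank_comap_eq {A B : Type*} [AddCommGroup A] [Module K A] [AddCommGroup B] [Module K B]
    [FiniteDimensional K A] (T : A →ₗ[K] B) (P : Submodule K B) :
    finrank K (P.comap T) = finrank K (P ⊓ LinearMap.range T : Submodule K B) +
      finrank K (LinearMap.ker T) := by
  rw [← LinearMap.finrank_range_add_finrank_ker (T.domRestrict (P.comap T)),
    LinearMap.range_domRestrict, Submodule.map_comap_eq, inf_comm, LinearMap.ker_domRestrict]
  congr 1
  have h : LinearMap.ker T ≤ P.comap T := fun x hx => by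
    rw [Submodule.mem_comap, LinearMap.mem_ker.1 hx]
    exact zero_mem _
  exact (Submodule.comapSubtypeEquivOfLe h).finrank_eq

variable [FiniteDimensional K V]

theorem sameJordanBlockSizes_glRep {e : sl K V} {u : SpecialLinearGroup K V}
    (hu : natRep K V u = 1 + (e : End K V)) (he : IsNilpotent (e : End K V)) :
    SameJordanBlockSizes (glRep K V u) (glAct e) :=
  (sameJordanBlockSizes_iff
    (isNilpotent_of_ker_pow_eq (ker_glRep_sub_one_pow hu) (isNilpotent_glAct he))
    (isNilpotent_glAct he)).2 fun k => by rw [ker_glRep_sub_one_pow hu]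

instance : FiniteDimensional K (sl K V) :=
  inferInstanceAs (FiniteDimensional K (LinearMap.ker (LinearMap.trace K V)))

theorem sameJordanBlockSizes_slRep {e : sl K V} {u : SpecialLinearGroup K V}
    (hu : natRep K V u = 1 + (e : End K V)) (he : IsNilpotent (e : End K V)) :
    SameJordanBlockSizes (slRep K V u) (slAct e) :=
  (sameJordanBlockSizes_iff (isNilpotent_slRep_sub_one hu he) (isNilpotent_slAct he)).2
    fun k => by rw [ker_slRep_sub_one_pow hu]

/-- For g on 𝔰𝔩(V) inducing f on 𝔭𝔰𝔩(V), the preimage of ker f is g⁻¹(Z), of dimension dim ker g +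
dim(Z ∩ im g). The kernels on 𝔰𝔩(V) agree, so only the intersections with the centre Z remain to be
compared. -/
theorem sameJordanBlockSizes_pslRep_iff {e : sl K V} {u : SpecialLinearGroup K V}
    (hu : natRep K V u = 1 + (e : End K V)) (he : IsNilpotent (e : End K V)) :
    SameJordanBlockSizes (pslRep K V u) (pslAct e) ↔ ∀ k,
      finrank K ((LieAlgebra.center K (sl K V)).toSubmodule ⊓
        LinearMap.range ((slRep K V u - 1) ^ k) : Submodule K (sl K V)) =
      finrank K ((LieAlgebra.center K (sl K V)).toSubmodule ⊓
        LinearMap.range (slAct e ^ k) : Submodule K (sl K V)) := by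
  rw [sameJordanBlockSizes_iff (isNilpotent_pslRep_sub_one hu he) (isNilpotent_pslAct he)]
  refine forall_congr' fun k => ?_
  set Z := (LieAlgebra.center K (sl K V)).toSubmodule
  have key (f : End K (psl K V)) (g : End K (sl K V))
      (h : ∀ x : sl K V, f (Submodule.Quotient.mk x) = Submodule.Quotient.mk (g x)) :
      finrank K (LinearMap.ker f) + finrank K Z =
        finrank K (Z ⊓ LinearMap.range g : Submodule K (sl K V)) +
          finrank K (LinearMap.ker g) := by
    have h1 := finrank_comap_eq Z.mkQ (LinearMap.ker f)
    rw [Submodule.range_mkQ, inf_top_eq, Submodule.ker_mkQ] at h1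
    have h2 : (LinearMap.ker f).comap Z.mkQ = Z.comap g := by
      ext x
      rw [Submodule.mem_comap, LinearMap.mem_ker, Submodule.mkQ_apply, Submodule.mem_comap]
      exact (Iff.of_eq (congrArg (· = 0) (h x))).trans (Submodule.Quotient.mk_eq_zero Z)
    rw [← finrank_comap_eq, ← h2]
    exact h1.symm
  have h1 := key _ _ (pslRep_sub_one_pow_mk u k)
  have h2 := key _ _ (pslAct_pow_mk e k)
  rw [ker_slRep_sub_one_pow hu] at h1
  omega

end Kernels

end JordanSL

namespace JordanSL

/-! ### The centre of 𝔰𝔩(V). -/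

section Center

open Module

variable {K V : Type*} [Field K] [AddCommGroup V] [Module K V]

theorem mem_sl_iff {x : End K V} : x ∈ sl K V ↔ LinearMap.trace K V x = 0 := Iff.rfl

theorem toLin_single_mem_sl {ι : Type*} [Fintype ι] [DecidableEq ι] (b : Basis ι K V) {i j : ι}
    (hij : i ≠ j) (c : K) : Matrix.toLin b b (Matrix.single i j c) ∈ sl K V := by
  rw [mem_sl_iff, Matrix.trace_toLin_eq, Matrix.trace_single_eq_of_ne _ _ _ hij]

theorem mem_center_sl_iff [FiniteDimensional K V] {x : sl K V} :
    x ∈ LieAlgebra.center K (sl K V) ↔ ∃ c : K, (x : End K V) = c • 1 := by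
  classical
  rw [LieModule.mem_maxTrivSubmodule]
  constructor
  · intro h
    let b := Free.chooseBasis K V
    obtain ⟨c, hc⟩ := Matrix.mem_range_scalar_of_commute_single
      (M := LinearMap.toMatrix b b (x : End K V)) fun i j hij => by
        have h1 : Matrix.toLin b b (Matrix.single i j 1) * (x : End K V) -
          x * Matrix.toLin b b (Matrix.single i j 1) = 0 :=
            congrArg Subtype.val (h ⟨_, toLin_single_mem_sl b hij 1⟩)
        have h2 := congrArg (LinearMap.toMatrix b b) (sub_eq_zero.1 h1)
        rwa [LinearMap.toMatrix_mul, LinearMap.toMatrix_mul, LinearMap.toMatrix_toLin] at h2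
    refine ⟨c, (LinearMap.toMatrix b b).injective ?_⟩
    rw [← hc, map_smul, LinearMap.toMatrix_one, Matrix.scalar_apply, Matrix.smul_one_eq_diagonal]
  · rintro ⟨c, hc⟩ y
    refine Subtype.ext ?_
    change (y : End K V) * x - x * y = 0
    rw [hc]
    simp

end Center

/-! ### Binomial coefficients modulo p. -/

section Binomials

variable {p : ℕ} [hp : Fact p.Prime]

/-- From k·C(d, k) = d·C(d − 1, k − 1): if p did not divide C(d, k), then p^a would divide k. -/
theorem dvd_choose_of_pow_dvd {a d k : ℕ} (hd : p ^ a ∣ d) (hk : 0 < k) (hk' : k < p ^ a) :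
    p ∣ d.choose k := by
  obtain ⟨k, rfl⟩ := Nat.exists_eq_add_of_lt hk
  rw [zero_add] at hk' ⊢
  cases d with
  | zero => simp
  | succ d =>
    by_contra h
    have h1 : p ^ a ∣ (d + 1).choose (k + 1) * (k + 1) := by
      rw [← Nat.add_one_mul_choose_eq]
      exact hd.mul_right _
    have h2 :=
      (Nat.Coprime.pow_left a ((Nat.Prime.coprime_iff_not_dvd hp.out).2 h)).dvd_of_dvd_mul_left h1
    exact absurd (Nat.le_of_dvd (Nat.succ_pos k) h2) (not_le.2 hk')

theorem choose_pow_mul_modEq (a c : ℕ) : (p ^ a * c).choose (p ^ a) ≡ c [MOD p] := by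
  induction a with
  | zero => simpa using Nat.ModEq.refl c
  | succ a ih =>
    have h := Choose.choose_modEq_choose_mod_mul_choose_div_nat (n := p ^ (a + 1) * c)
      (k := p ^ (a + 1)) (p := p)
    rw [pow_succ', mul_assoc, Nat.mul_mod_right, Nat.mul_mod_right, Nat.choose_self, one_mul,
      Nat.mul_div_cancel_left _ hp.out.pos, Nat.mul_div_cancel_left _ hp.out.pos] at h
    rw [pow_succ', mul_assoc]
    exact h.trans ih

theorem sum_fin_choose (d m : ℕ) : ∑ j : Fin d, (j : ℕ).choose m = d.choose (m + 1) := by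
  rw [Fin.sum_univ_eq_sum_range fun j => j.choose m]
  induction d with
  | zero => simp
  | succ d ih => rw [Finset.sum_range_succ, ih, Nat.choose_succ_succ, add_comm]

end Binomials

/-! ### Divided powers and projections on Jordan chains. -/

section Chains

open Module

variable {K V : Type*} [Field K] [AddCommGroup V] [Module K V]
variable {t : ℕ} {d : Fin t → ℕ} (b : Basis (Σ i : Fin t, Fin (d i)) K V)

/-- The `j`-th vector of the `i`-th Jordan chain, extended by zero. -/
noncomputable def chainVec (i : Fin t) (j : ℕ) : V := if h : j < d i then b ⟨i, ⟨j, h⟩⟩ else 0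

theorem chainVec_of_lt {i : Fin t} {j : ℕ} (h : j < d i) : chainVec b i j = b ⟨i, ⟨j, h⟩⟩ :=
  dif_pos h

theorem chainVec_of_le {i : Fin t} {j : ℕ} (h : d i ≤ j) : chainVec b i j = 0 :=
  dif_neg (not_lt.2 h)

theorem repr_chainVec (i : Fin t) (m : ℕ) (j : Fin (d i)) :
    b.repr (chainVec b i m) ⟨i, j⟩ = if m = j then 1 else 0 := by
  by_cases h : m < d i
  · rw [chainVec_of_lt b h, Basis.repr_self, Finsupp.single_apply]
    simp [Fin.ext_iff]
  · rw [chainVec_of_le b (not_lt.1 h), if_neg]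
    · simp
    · have := j.2
      omega

theorem ext_chainVec {f g : End K V}
    (h : ∀ i j, j < d i → f (chainVec b i j) = g (chainVec b i j)) : f = g :=
  b.ext fun ⟨i, j⟩ => by simpa [chainVec_of_lt b j.2] using h i j j.2

theorem trace_eq_sum_chainVec (f : End K V) :
    LinearMap.trace K V f = ∑ i, ∑ j : Fin (d i), b.repr (f (chainVec b i j)) ⟨i, j⟩ := by
  rw [LinearMap.trace_eq_matrix_trace K b, Matrix.trace, Fintype.sum_sigma]
  simp only [Matrix.diag_apply, LinearMap.toMatrix_apply]
  refine Finset.sum_congr rfl fun i _ => Finset.sum_congr rfl fun j _ => ?_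
  rw [chainVec_of_lt b j.2]

/-- On each Jordan chain, multiplication by the `k`-th divided power. -/
noncomputable def dividedPower (k : ℕ) : End K V :=
  b.constr K fun x => ((x.2 + k : ℕ).choose k : K) • chainVec b x.1 (x.2 + k)

theorem dividedPower_apply (k : ℕ) {i : Fin t} {j : ℕ} (h : j < d i) :
    dividedPower b k (chainVec b i j) = ((j + k).choose k : K) • chainVec b i (j + k) := by
  rw [chainVec_of_lt b h, dividedPower, Basis.constr_basis]

theorem dividedPower_zero : dividedPower b 0 = 1 :=
  ext_chainVec b fun i j h => by simp [dividedPower_apply b 0 h]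

/-- On the `i₀`-th Jordan chain, the projection to the span of the vectors with index `-1`
modulo `q`. -/
noncomputable def chainProj (i₀ : Fin t) (q : ℕ) : End K V :=
  b.constr K fun x => if x.1 = i₀ ∧ q ∣ x.2 + 1 then b x else 0

theorem chainProj_apply (i₀ : Fin t) (q : ℕ) (i : Fin t) (j : ℕ) :
    chainProj b i₀ q (chainVec b i j) = if i = i₀ ∧ q ∣ j + 1 then chainVec b i j else 0 := by
  by_cases h : j < d i
  · rw [chainVec_of_lt b h, chainProj, Basis.constr_basis]
  · simp [chainVec_of_le b (not_lt.1 h)]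

theorem trace_chainProj (i₀ : Fin t) (q : ℕ) :
    LinearMap.trace K V (chainProj b i₀ q) = (d i₀ / q : ℕ) := by
  rw [trace_eq_sum_chainVec b, Finset.sum_eq_single i₀]
  · rw [← Nat.card_multiples, Finset.card_filter, Nat.cast_sum, ← Fin.sum_univ_eq_sum_range
      (fun j => ((if q ∣ j + 1 then 1 else 0 : ℕ) : K))]
    refine Finset.sum_congr rfl fun j _ => ?_
    rw [chainProj_apply]
    simp only [true_and]
    split_ifs <;> simp [repr_chainVec]
  · intro i _ hi
    refine Finset.sum_eq_zero fun j _ => ?_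
    rw [chainProj_apply, if_neg fun h => hi h.1]
    simp
  · simp

variable {b} {e : sl K V}
  (hb : ∀ (i : Fin t) (j : Fin (d i)), (e : End K V) (b ⟨i, j⟩) = (0 : K) • b ⟨i, j⟩ +
    (if (j : ℕ) = 0 then 0 else b ⟨i, ⟨(j : ℕ) - 1, lt_of_le_of_lt (Nat.sub_le _ _) j.2⟩⟩))
include hb

theorem pow_apply_chainVec (k : ℕ) {i : Fin t} {j : ℕ} (h : j < d i) :
    ((e : End K V) ^ k) (chainVec b i j) = if j < k then 0 else chainVec b i (j - k) := by
  rw [chainVec_of_lt b h, HasJordanBlocks.pow_apply hb, chainVec_of_lt b (by omega : j - k < d i)]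

/-- `e ^ l` lowers indices by l and the divided power raises them by m, so diagonal entries occur
only for l = m. They are then C(j, m), and the hockey-stick identity sums them. -/
theorem trace_dividedPower_mul_pow (m l : ℕ) :
    LinearMap.trace K V (dividedPower b m * (e : End K V) ^ l) =
      if l = m then ∑ i, ((d i).choose (m + 1) : K) else 0 := by
  rw [trace_eq_sum_chainVec b]
  have key (i : Fin t) (j : Fin (d i)) :
      b.repr ((dividedPower b m * (e : End K V) ^ l) (chainVec b i j)) ⟨i, j⟩ =
        if l = m then ((j : ℕ).choose m : K) else 0 := by
    rw [End.mul_apply, pow_apply_chainVec hb l j.2]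
    split_ifs with h1 h2 h2
    · subst h2
      simp [Nat.choose_eq_zero_of_lt h1]
    · simp
    · subst h2
      rw [dividedPower_apply b _ (by omega), map_smul, Finsupp.smul_apply, repr_chainVec,
        if_pos (by omega), Nat.sub_add_cancel (not_lt.1 h1), smul_eq_mul, mul_one]
    · rw [dividedPower_apply b _ (by omega), map_smul, Finsupp.smul_apply, repr_chainVec,
        if_neg (by omega), smul_zero]
  simp only [key]
  split_ifs with h
  · refine Finset.sum_congr rfl fun i _ => ?_
    rw [← sum_fin_choose, Nat.cast_sum]
  · simp

variable {p : ℕ} [hp : Fact p.Prime] [CharP K p]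

/-- If chain vectors are viewed as divided powers x^{(j)}, then e is d/dx and this is [d/dx,
x^{(k+1)}] = x^{(k)}. Truncating chains at d_i does no harm because C(d_i, k + 1) ≡ 0 mod p. -/
theorem glAct_dividedPower {a k : ℕ} (hd : ∀ i, p ^ a ∣ d i) (hk : k + 1 < p ^ a) :
    glAct e (dividedPower b (k + 1)) = dividedPower b k := by
  refine ext_chainVec b fun i j h => ?_
  have hE (l : ℕ) : (e : End K V) (chainVec b i l) =
      if l < d i ∧ l ≠ 0 then chainVec b i (l - 1) else 0 := by
    by_cases hl : l < d i
    · have := pow_apply_chainVec hb 1 hl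
      rw [pow_one] at this
      rw [this]
      split_ifs <;> first | rfl | omega
    · rw [chainVec_of_le b (not_lt.1 hl), map_zero, if_neg fun h => hl h.1]
  have hle := Nat.le_of_dvd (by omega) (hd i)
  rw [glAct_apply, LinearMap.sub_apply, End.mul_apply, End.mul_apply, dividedPower_apply b _ h,
    dividedPower_apply b _ h, map_smul, hE, hE j]
  have h2 : (if j < d i ∧ j ≠ 0 then chainVec b i (j - 1) else 0) =
      if j = 0 then 0 else chainVec b i (j - 1) := by split_ifs <;> first | rfl | omega
  rw [h2]
  rcases Nat.eq_zero_or_pos j with rfl | hj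
  · rw [if_pos (by omega), if_pos rfl]
    simp
  · obtain ⟨j, rfl⟩ := Nat.exists_eq_add_of_lt hj
    rw [zero_add] at *
    rw [if_neg (Nat.succ_ne_zero j), Nat.add_sub_cancel, dividedPower_apply b _ (by omega)]
    have e1 : j + 1 + (k + 1) - 1 = j + (k + 1) := by omega
    have e2 : j + 1 + k = j + (k + 1) := by omega
    rw [e1, e2]
    have pascal : (j + 1 + (k + 1)).choose (k + 1) =
        (j + (k + 1)).choose k + (j + (k + 1)).choose (k + 1) := by
      rw [show j + 1 + (k + 1) = j + (k + 1) + 1 by omega, Nat.choose_succ_succ]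
    rcases lt_trichotomy (j + 1 + (k + 1)) (d i) with h3 | h3 | h3
    · rw [if_pos ⟨h3, by omega⟩, pascal, ← sub_smul]
      congr 1
      push_cast
      ring
    -- Boundary case: one term of the commutator leaves the chain, and the missing coefficient
    -- C(d_i, k + 1) vanishes in `K`.
    · rw [if_neg (by omega), smul_zero, zero_sub, ← neg_smul]
      congr 1
      have h4 := (CharP.cast_eq_zero_iff K p _).2
        (dvd_choose_of_pow_dvd (hd i) (Nat.succ_pos k) hk)
      rw [← h3, pascal] at h4
      push_cast at h4
      linear_combination -h4
    · rw [if_neg (by omega), chainVec_of_le b (by omega)]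
      simp

theorem glAct_pow_dividedPower {a k : ℕ} (hd : ∀ i, p ^ a ∣ d i) (hk : k < p ^ a) :
    (glAct e ^ k) (dividedPower b k) = 1 := by
  induction k with
  | zero => rw [dividedPower_zero]; rfl
  | succ k ih =>
    rw [pow_succ, End.mul_apply, glAct_dividedPower hb hd hk, ih (by omega)]

/-- In characteristic p, (ad e)^q = ad(e^q) for q = p^a. The power e^q shifts indices by q, which
preserves residues modulo q, so it commutes with the projection. -/
theorem glAct_pow_chainProj [Nontrivial V] (i₀ : Fin t) (a : ℕ) :
    (glAct e ^ p ^ a) (chainProj b i₀ (p ^ a)) = 0 := by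
  have : CharP (End K (End K V)) p := charP_of_injective_algebraMap
    (algebraMap K (End K (End K V))).injective p
  have h1 : glAct e = LinearMap.mulLeft K (e : End K V) - LinearMap.mulRight K (e : End K V) :=
    congrFun (LieAlgebra.ad_eq_lmul_left_sub_lmul_right (R := K) (End K V)) _
  rw [h1, sub_pow_char_pow_of_commute p a (LinearMap.commute_mulLeft_right _ _),
    LinearMap.pow_mulLeft, LinearMap.pow_mulRight, LinearMap.sub_apply, LinearMap.mulLeft_apply,
    LinearMap.mulRight_apply, sub_eq_zero]
  refine ext_chainVec b fun i j h => ?_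
  rw [End.mul_apply, End.mul_apply, chainProj_apply, pow_apply_chainVec hb _ h]
  rcases lt_or_ge j (p ^ a) with h1 | h1
  · rw [if_pos h1, map_zero]
    split_ifs with h2
    · rw [pow_apply_chainVec hb _ h, if_pos h1]
    · rw [map_zero]
  · rw [if_neg (not_lt.2 h1), chainProj_apply]
    have h2 : p ^ a ∣ j + 1 ↔ p ^ a ∣ j - p ^ a + 1 := by
      rw [show j + 1 = j - p ^ a + 1 + p ^ a by omega, Nat.dvd_add_self_right]
    simp only [h2]
    split_ifs with h3
    · rw [pow_apply_chainVec hb _ h, if_neg (not_lt.2 h1)]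
    · rw [map_zero]

end Chains

end JordanSL

namespace JordanSL

/-! ### The criterion on 𝔭𝔰𝔩(V). -/

section PSL

open Module

variable {K V : Type*} [Field K] [AddCommGroup V] [Module K V]

theorem trace_mul_glAct_pow (e : sl K V) (k : ℕ) (z x : End K V) :
    LinearMap.trace K V (z * (glAct e ^ k) x) =
      (-1) ^ k * LinearMap.trace K V ((glAct e ^ k) z * x) := by
  induction k generalizing z with
  | zero => simp
  | succ k ih =>
    have h (y w : End K V) : LinearMap.trace K V (y * glAct e w) =
        - LinearMap.trace K V (glAct e y * w) := by
      rw [glAct_apply, glAct_apply, mul_sub, sub_mul, map_sub, map_sub, ← mul_assoc, ← mul_assoc,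
        mul_assoc (e : End K V) y w, LinearMap.trace_mul_comm K (e : End K V) (y * w)]
      ring
    rw [pow_succ' (glAct e), End.mul_apply, h, ih, ← End.mul_apply, ← pow_succ, ← pow_succ']
    ring

/-- By skewness, tr z = tr(z·(ad e)^k x) = ± tr((ad e)^k z · x) = 0. This serves both to show that 1
is not in an image and to show that all preimages of an element have the same trace. -/
theorem trace_eq_zero_of_glAct_pow_eq_zero {e : sl K V} {k : ℕ} {z x : End K V}
    (hx : (glAct e ^ k) x = 1) (hz : (glAct e ^ k) z = 0) : LinearMap.trace K V z = 0 := by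
  have := trace_mul_glAct_pow e k z x
  rwa [hx, hz, mul_one, zero_mul, map_zero, mul_zero] at this

theorem trace_glAct (e : sl K V) (x : End K V) : LinearMap.trace K V (glAct e x) = 0 := by
  rw [glAct_apply, map_sub, LinearMap.trace_mul_comm, sub_self]

theorem HasJordanBlocks.sum_eq_finrank {f : End K V} {μ : K} {t : ℕ} {d : Fin t → ℕ}
    (h : HasJordanBlocks f μ d) : ∑ i, d i = finrank K V := by
  obtain ⟨-, b, -⟩ := h
  rw [finrank_eq_card_basis b]
  simp

variable {p : ℕ} [CharP K p]

/-- The trace that obstructs the equality of Jordan block sizes on `𝔭𝔰𝔩(V)`. -/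
theorem trace_dividedPower_mul_one_add_pow [hp : Fact p.Prime] {t : ℕ} {d : Fin t → ℕ}
    {b : Basis (Σ i : Fin t, Fin (d i)) K V} {e : sl K V}
    (hb : ∀ (i : Fin t) (j : Fin (d i)), (e : End K V) (b ⟨i, j⟩) = (0 : K) • b ⟨i, j⟩ +
      (if (j : ℕ) = 0 then 0 else b ⟨i, ⟨(j : ℕ) - 1, lt_of_le_of_lt (Nat.sub_le _ _) j.2⟩⟩))
    {a k : ℕ} (hk : k + 1 = p ^ a) (hd : ∀ i, p ^ a ∣ d i) :
    LinearMap.trace K V (dividedPower b k * (1 + (e : End K V)) ^ k) =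
      ((∑ i, d i) / p ^ a : ℕ) := by
  -- Only the term e^k of (1 + e)^k has a trace against the divided power. It contributes Σ C(d_i,
  -- p^a), which is Σ d_i/p^a modulo p by Lucas.
  rw [add_comm, (Commute.one_right (e : End K V)).add_pow, Finset.mul_sum, map_sum,
    Finset.sum_eq_single k]
  · rw [one_pow, mul_one, Nat.choose_self, Nat.cast_one, mul_one, trace_dividedPower_mul_pow hb,
      if_pos rfl, ← Nat.cast_sum, CharP.cast_eq_iff_mod_eq K p]
    rw [Nat.sum_div fun i _ => hd i]
    refine Nat.ModEq.sum fun i _ => ?_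
    obtain ⟨c, hc⟩ := hd i
    rw [hk, hc, Nat.mul_div_cancel_left _ (pow_pos hp.out.pos a)]
    exact choose_pow_mul_modEq a c
  · intro l _ hl
    rw [one_pow, mul_one, ← nsmul_eq_mul', mul_smul_comm, map_nsmul,
      trace_dividedPower_mul_pow hb, if_neg hl, smul_zero]
  · simp

variable [FiniteDimensional K V]

theorem trace_one_eq_zero_iff : LinearMap.trace K V 1 = 0 ↔ p ∣ finrank K V := by
  rw [LinearMap.trace_one, CharP.cast_eq_zero_iff K p]

theorem center_sl_eq_bot [Nontrivial V] (h : ¬ p ∣ finrank K V) :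
    (LieAlgebra.center K (sl K V)).toSubmodule = ⊥ := by
  refine (Submodule.eq_bot_iff _).2 fun x hx => ?_
  obtain ⟨c, hc⟩ := mem_center_sl_iff.1 hx
  have h1 := x.2
  rw [mem_sl_iff, hc, map_smul, smul_eq_mul, mul_eq_zero, trace_one_eq_zero_iff (p := p)] at h1
  refine Subtype.ext ?_
  rw [hc, h1.resolve_right h, zero_smul]
  rfl

theorem finrank_center_inf_eq_iff [Nontrivial V] (h : p ∣ finrank K V)
    (A B : Submodule K (sl K V)) :
    finrank K ((LieAlgebra.center K (sl K V)).toSubmodule ⊓ A : Submodule K (sl K V)) =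
      finrank K ((LieAlgebra.center K (sl K V)).toSubmodule ⊓ B : Submodule K (sl K V)) ↔
    ((∃ x ∈ A, (x : End K V) = 1) ↔ ∃ x ∈ B, (x : End K V) = 1) := by
  set Z := (LieAlgebra.center K (sl K V)).toSubmodule
  have h1 : (1 : End K V) ∈ sl K V := trace_one_eq_zero_iff.2 h
  let o : sl K V := ⟨1, h1⟩
  have ho : o ≠ 0 := fun ho => one_ne_zero (congrArg Subtype.val ho : (1 : End K V) = 0)
  have hZ : Z = Submodule.span K {o} := by
    ext x
    rw [Submodule.mem_span_singleton]
    refine mem_center_sl_iff.trans (exists_congr fun c => ?_)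
    rw [← Subtype.coe_inj, eq_comm]
    rfl
  have hA (A : Submodule K (sl K V)) : (∃ x ∈ A, (x : End K V) = 1) ↔ o ∈ A :=
    ⟨fun ⟨x, hx, hx'⟩ => by rwa [show o = x from Subtype.ext hx'.symm], fun h => ⟨o, h, rfl⟩⟩
  have key (A : Submodule K (sl K V)) :
      finrank K (Z ⊓ A : Submodule K (sl K V)) = 1 ∧ o ∈ A ∨
      finrank K (Z ⊓ A : Submodule K (sl K V)) = 0 ∧ o ∉ A := by
    by_cases hoA : o ∈ A
    · refine Or.inl ⟨?_, hoA⟩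
      rw [inf_eq_left.2, hZ, finrank_span_singleton ho]
      rwa [hZ, Submodule.span_singleton_le_iff_mem]
    · refine Or.inr ⟨?_, hoA⟩
      rw [hZ, inf_comm, ((Submodule.disjoint_span_singleton' ho).2 hoA).eq_bot, finrank_bot]
  rw [hA, hA]
  rcases key A with ⟨h1, h2⟩ | ⟨h1, h2⟩ <;> rcases key B with ⟨h3, h4⟩ | ⟨h3, h4⟩ <;>
    simp [h1, h2, h3, h4]

theorem sameJordanBlockSizes_pslRep_of_not_dvd [Nontrivial V] (h : ¬ p ∣ finrank K V) {e : sl K V}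
    {u : SpecialLinearGroup K V} (hu : natRep K V u = 1 + (e : End K V))
    (he : IsNilpotent (e : End K V)) : SameJordanBlockSizes (pslRep K V u) (pslAct e) :=
  (sameJordanBlockSizes_pslRep_iff hu he).2 fun k => by
    rw [center_sl_eq_bot h, bot_inf_eq, bot_inf_eq]

/-- The centre is the line through 1, so an image meets it nontrivially exactly when it contains 1.
The factor u^{-k} turns reaching 1 by (Ad u − 1)^k into reaching u^k by (ad e)^k. -/
theorem sameJordanBlockSizes_pslRep_iff_exists [Nontrivial V] (h : p ∣ finrank K V) {e : sl K V}
    {u : SpecialLinearGroup K V} (hu : natRep K V u = 1 + (e : End K V))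
    (he : IsNilpotent (e : End K V)) : SameJordanBlockSizes (pslRep K V u) (pslAct e) ↔
      ∀ k, (∃ x ∈ sl K V, (glAct e ^ k) x = natRep K V u ^ k) ↔
        ∃ x ∈ sl K V, (glAct e ^ k) x = 1 := by
  rw [sameJordanBlockSizes_pslRep_iff hu he]
  refine forall_congr' fun k => ?_
  rw [finrank_center_inf_eq_iff h]
  refine iff_congr ⟨?_, ?_⟩ ⟨?_, ?_⟩
  · rintro ⟨_, ⟨x, rfl⟩, hx⟩
    rw [coe_slRep_sub_one_pow, glRep_sub_one_pow_apply_eq_iff hu, one_mul] at hx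
    exact ⟨x, x.2, hx⟩
  · rintro ⟨x, hx, hx'⟩
    refine ⟨_, ⟨⟨x, hx⟩, rfl⟩, ?_⟩
    rw [coe_slRep_sub_one_pow, glRep_sub_one_pow_apply_eq_iff hu, one_mul]
    exact hx'
  · rintro ⟨_, ⟨x, rfl⟩, hx⟩
    rw [coe_slAct_pow] at hx
    exact ⟨x, x.2, hx⟩
  · rintro ⟨x, hx, hx'⟩
    exact ⟨_, ⟨⟨x, hx⟩, rfl⟩, by rw [coe_slAct_pow]; exact hx'⟩

theorem sameJordanBlockSizes_pslRep_iff_dvd [hp : Fact p.Prime] [Nontrivial V]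
    (h : p ∣ finrank K V) {e : sl K V}
    {u : SpecialLinearGroup K V} (hu : natRep K V u = 1 + (e : End K V)) {t : ℕ} {d : Fin t → ℕ}
    (he : HasJordanBlocks (e : End K V) 0 d) :
    SameJordanBlockSizes (pslRep K V u) (pslAct e) ↔
      p ^ (padicValNat p (Finset.univ.gcd d) + 1) ∣ finrank K V := by
  rw [sameJordanBlockSizes_pslRep_iff_exists h hu he.isNilpotent, ← he.sum_eq_finrank]
  have hsum := he.sum_eq_finrank
  obtain ⟨hd1, b, hb⟩ := he
  set a := padicValNat p (Finset.univ.gcd d) with ha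
  have hd (i : Fin t) : p ^ a ∣ d i := pow_padicValNat_dvd.trans (Finset.gcd_dvd (Finset.mem_univ i))
  have hpos : 0 < p ^ a := pow_pos hp.out.pos a
  -- A block whose size has p-adic valuation exactly a; its projection will have nonzero trace
  -- d_{i₀}/p^a.
  obtain ⟨i₀, hi₀⟩ : ∃ i, ¬ p ^ (a + 1) ∣ d i := by
    by_contra! hcon
    have hg : Finset.univ.gcd d ≠ 0 := by
      intro h0
      rw [Finset.gcd_eq_zero_iff] at h0
      have : 0 < finrank K V := finrank_pos
      rw [← hsum, Finset.sum_eq_zero h0] at this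
      exact lt_irrefl 0 this
    exact pow_succ_padicValNat_not_dvd hg (Finset.dvd_gcd fun i _ => hcon i)
  have hcomm (k : ℕ) : Commute (natRep K V u ^ k) (e : End K V) := (commute_natRep hu).pow_left k
  have hU (k : ℕ) (x : End K V) (hx : (glAct e ^ k) x = 1) :
      (glAct e ^ k) (x * natRep K V u ^ k) = natRep K V u ^ k := by
    rw [glAct_pow_mul_of_commute (hcomm k), hx, one_mul]
  -- Below p^a − 1 there is one more divided power available, so preimages can be chosen as
  -- commutators with e, hence traceless.
  have hsmall (k : ℕ) (hk : k + 1 < p ^ a) : (∃ x ∈ sl K V, (glAct e ^ k) x = natRep K V u ^ k) ∧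
      ∃ x ∈ sl K V, (glAct e ^ k) x = 1 := by
    have h1 : (glAct e ^ k) (glAct e (dividedPower b (k + 1))) = 1 := by
      rw [glAct_dividedPower hb hd hk, glAct_pow_dividedPower hb hd (by omega)]
    refine ⟨⟨glAct e (dividedPower b (k + 1) * natRep K V u ^ k), trace_glAct _ _, ?_⟩,
      glAct e (dividedPower b (k + 1)), trace_glAct _ _, h1⟩
    have h2 := glAct_pow_mul_of_commute (hcomm k) 1 (dividedPower b (k + 1))
    rw [pow_one] at h2
    rw [h2]
    exact hU k _ h1
  have hbig (k : ℕ) (hk : p ^ a ≤ k) (x : End K V) : (glAct e ^ k) x ≠ 1 := by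
    intro hx
    have hz : (glAct e ^ k) (chainProj b i₀ (p ^ a)) = 0 := by
      rw [← Nat.sub_add_cancel hk, pow_add, End.mul_apply, glAct_pow_chainProj hb i₀ a, map_zero]
    have htr := trace_eq_zero_of_glAct_pow_eq_zero hx hz
    rw [trace_chainProj, CharP.cast_eq_zero_iff K p] at htr
    apply hi₀
    rw [pow_succ]
    exact Nat.mul_dvd_of_dvd_div (hd i₀) htr
  have hbigu (k : ℕ) (hk : p ^ a ≤ k) (x : End K V) : (glAct e ^ k) x ≠ natRep K V u ^ k := by
    intro hx
    -- Multiplying a preimage of u^k by u^{-k} on the right would give a preimage of 1.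
    rw [← one_mul (natRep K V u ^ k), ← glRep_sub_one_pow_apply_eq_iff hu,
      glRep_sub_one_pow_apply hu,
      ← glAct_pow_mul_of_commute ((commute_natRep_inv hu).pow_left k)] at hx
    exact hbig k hk _ hx
  obtain ⟨m, hm⟩ : ∃ m, m + 1 = p ^ a := ⟨p ^ a - 1, by omega⟩
  have h1 : (glAct e ^ m) (dividedPower b m) = 1 := glAct_pow_dividedPower hb hd (by omega)
  have hmid1 : ∃ x ∈ sl K V, (glAct e ^ m) x = 1 := by
    refine ⟨_, ?_, h1⟩
    -- The divided power is traceless for m > 0; for m = 0, that is p^a = 1, it is the identity, of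
    -- trace n ≡ 0.
    have h2 := trace_dividedPower_mul_pow hb m 0
    rw [pow_zero, mul_one] at h2
    rw [mem_sl_iff, h2]
    split_ifs with h0
    · subst h0
      simp only [zero_add, Nat.choose_one_right]
      rw [← Nat.cast_sum, hsum, CharP.cast_eq_zero_iff K p]
      exact h
    · rfl
  have hmid2 : (∃ x ∈ sl K V, (glAct e ^ m) x = natRep K V u ^ m) ↔ p ^ (a + 1) ∣ ∑ i, d i := by
    have htr := trace_dividedPower_mul_one_add_pow hb hm hd
    rw [← hu] at htr
    have hdvd : p ^ (a + 1) ∣ ∑ i, d i ↔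
        LinearMap.trace K V (dividedPower b m * natRep K V u ^ m) = 0 := by
      rw [htr, CharP.cast_eq_zero_iff K p, pow_succ,
        Nat.dvd_div_iff_mul_dvd (Finset.dvd_sum fun i _ => hd i)]
    rw [hdvd]
    constructor
    · rintro ⟨x, hx, hx'⟩
      -- Any traceless solution differs from the explicit one by a kernel element, which has trace
      -- zero; so the explicit solution decides.
      have h3 : (glAct e ^ m) (x - dividedPower b m * natRep K V u ^ m) = 0 := by
        rw [map_sub, hx', hU m _ h1, sub_self]
      have h4 := trace_eq_zero_of_glAct_pow_eq_zero h1 h3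
      rwa [map_sub, mem_sl_iff.1 hx, zero_sub, neg_eq_zero] at h4
    · exact fun h0 => ⟨_, h0, hU m _ h1⟩
  rw [← hmid2]
  constructor
  · exact fun hall => (hall m).2 hmid1
  · intro hmid k
    rcases lt_trichotomy (k + 1) (p ^ a) with hk | hk | hk
    · exact iff_of_true (hsmall k hk).1 (hsmall k hk).2
    · obtain rfl : k = m := by omega
      exact iff_of_true hmid hmid1
    · exact iff_of_false (fun ⟨x, _, hx⟩ => hbigu k (by omega) x hx)
        fun ⟨x, _, hx⟩ => hbig k (by omega) x hx

end PSL

end JordanSL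

namespace JordanSL

open Module Polynomial

/-! ### Reduction to u = 1 + e. -/

section Conjugation

variable {K V : Type*} [Field K] [AddCommGroup V] [Module K V]

theorem natRep_apply (g : SpecialLinearGroup K V) (v : V) : natRep K V g v = g v := rfl

variable [FiniteDimensional K V]

/-- An endomorphism of determinant one, as an element of `SL(V)`. -/
noncomputable def slOfDet (f : End K V) (hf : LinearMap.det f = 1) : SpecialLinearGroup K V :=
  ⟨LinearMap.equivOfDetNeZero f (by rw [hf]; exact one_ne_zero), Units.ext (by
    rw [LinearEquiv.coe_det]; exact hf)⟩

theorem exists_conj_eq_one_add [IsAlgClosed K] [Nontrivial V] {e : sl K V}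
    {u : SpecialLinearGroup K V} {t : ℕ} {d : Fin t → ℕ} (he : HasJordanBlocks (e : End K V) 0 d)
    (hu : HasJordanBlocks (natRep K V u) 1 d) :
    ∃ g : SpecialLinearGroup K V, natRep K V (g⁻¹ * u * g) = 1 + (e : End K V) := by
  obtain ⟨-, b, hb⟩ := he
  obtain ⟨-, b', hb'⟩ := hu
  let g₀ : V ≃ₗ[K] V := b.equiv b' (Equiv.refl _)
  have hg₀ (x) : g₀ (b x) = b' x := by simp [g₀]
  have hdet : LinearMap.det (g₀ : End K V) ≠ 0 := (LinearEquiv.isUnit_det' g₀).ne_zero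
  -- Scaling by an n-th root of the inverse determinant puts the change of Jordan basis into SL(V)
  -- without affecting conjugation.
  obtain ⟨c, hc⟩ := IsAlgClosed.exists_pow_nat_eq (LinearMap.det (g₀ : End K V))⁻¹
    (n := finrank K V) finrank_pos
  let g : SpecialLinearGroup K V := slOfDet (c • (g₀ : End K V)) (by
    rw [LinearMap.det_smul, hc, inv_mul_cancel₀ hdet])
  have hg (x) : natRep K V g (b x) = c • b' x := by
    change c • g₀ (b x) = _
    rw [hg₀]
  have h : natRep K V u * natRep K V g = natRep K V g * (1 + (e : End K V)) := by
    refine b.ext fun ⟨i, j⟩ => ?_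
    rw [End.mul_apply, End.mul_apply, hg, map_smul, hb', LinearMap.add_apply, End.one_apply, hb,
      zero_smul, zero_add, map_add, hg, one_smul, smul_add]
    congr 1
    split_ifs <;> simp [hg]
  refine ⟨g, ?_⟩
  rw [map_mul, map_mul, mul_assoc, h, ← mul_assoc, natRep_inv_mul, one_mul]

theorem sameJordanBlockSizes_conj_iff {G W : Type*} [Group G] [AddCommGroup W] [Module K W]
    (ρ : Representation K G W) (g u : G) (y : End K W) :
    SameJordanBlockSizes (ρ (g⁻¹ * u * g)) y ↔ SameJordanBlockSizes (ρ u) y := by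
  have key (g u : G) (h : SameJordanBlockSizes (ρ u) y) :
      SameJordanBlockSizes (ρ (g⁻¹ * u * g)) y := by
    have h1 (g : G) : (ρ g) ∘ₗ ρ g⁻¹ = LinearMap.id := by
      rw [← Module.End.mul_eq_comp, ← map_mul, mul_inv_cancel, map_one]
      rfl
    have h2 := h1 g⁻¹
    rw [inv_inv] at h2
    refine h.conj (LinearEquiv.ofLinearMap (ρ g⁻¹) (ρ g) h2 (h1 g)) (LinearEquiv.refl K W)
      (fun w => ?_) (fun w => rfl)
    change ρ g⁻¹ (ρ u w) = ρ (g⁻¹ * u * g) (ρ g⁻¹ w)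
    simp only [← End.mul_apply, ← map_mul]
    rw [mul_assoc (g⁻¹ * u), mul_inv_cancel, mul_one]
  refine ⟨fun h => ?_, key g u⟩
  have := key g⁻¹ _ h
  rwa [show g⁻¹⁻¹ * (g⁻¹ * u * g) * g⁻¹ = u by group] at this

end Conjugation

/-! ### Polynomial curves in SL(V). -/

section Curves

variable {K V : Type*} [Field K] [AddCommGroup V] [Module K V]
variable {ι : Type*} [Fintype ι] [DecidableEq ι]

/-- The element of `SL(V)` with a given matrix. -/
noncomputable def slOfMatrix (b : Basis ι K V) :
    Matrix.SpecialLinearGroup ι K ≃* SpecialLinearGroup K V :=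
  Matrix.SpecialLinearGroup.toLin_equiv b

theorem toMatrix_natRep (b : Basis ι K V) (g : SpecialLinearGroup K V) :
    LinearMap.toMatrix b b (natRep K V g) = (slOfMatrix b).symm g := rfl

/-- The polynomial curve in `SL(V)` given by a matrix in `SL_n(K[X])`. -/
noncomputable def polyCurve (b : Basis ι K V) (A : Matrix.SpecialLinearGroup ι K[X]) (r : K) :
    SpecialLinearGroup K V :=
  slOfMatrix b (Matrix.SpecialLinearGroup.map (evalRingHom r) A)

theorem polyCurve_eq (b : Basis ι K V) (A : Matrix.SpecialLinearGroup ι K[X]) (r : K)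
    {B : Matrix.SpecialLinearGroup ι K} (h : ∀ i j, (A i j).eval r = B i j) :
    polyCurve b A r = slOfMatrix b B := by
  rw [polyCurve]
  congr 1
  ext i j
  exact h i j

theorem apply_natRep_eq_sum (b : Basis ι K V) (φ : Dual K V) (v : V) (g : SpecialLinearGroup K V) :
    φ (natRep K V g v) = ∑ i, ∑ j, φ (b i) * ((slOfMatrix b).symm g i j * b.repr v j) := by
  rw [← toMatrix_natRep]
  have h : natRep K V g v = ∑ i, (∑ j, LinearMap.toMatrix b b (natRep K V g) i j * b.repr v j) •
      b i := by
    rw [← b.sum_repr (natRep K V g v)]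
    refine Finset.sum_congr rfl fun i _ => ?_
    rw [← LinearMap.toMatrix_mulVec_repr b b]
    rfl
  rw [h, map_sum]
  refine Finset.sum_congr rfl fun i _ => ?_
  rw [map_smul, smul_eq_mul, mul_comm, Finset.mul_sum]

theorem matrixCoeff_mem (φ : Dual K V) (v : V) :
    (fun g => φ (natRep K V g v)) ∈ regularFunctions K V :=
  Algebra.subset_adjoin ⟨φ, v, rfl⟩

/-- Matrix coefficients restrict to polynomials in r, hence so do all regular functions. Over an
infinite field a polynomial is determined by its values, so restriction is an algebra map to K[X].
-/
theorem exists_polyCurve_pullback [Infinite K] (b : Basis ι K V)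
    (A : Matrix.SpecialLinearGroup ι K[X]) :
    ∃ Φ : regularFunctions K V →ₐ[K] K[X],
      ∀ f r, (Φ f).eval r = f.1 (polyCurve b A r) := by
  let ev : K[X] →ₐ[K] (K → K) := AlgHom.pi fun r => aeval r
  have hev : Function.Injective ev := fun P Q h => funext fun r => by
    simpa [ev, aeval_def] using congrFun h r
  let res : regularFunctions K V →ₐ[K] (K → K) :=
    (AlgHom.pi fun r => Pi.evalAlgHom K (fun _ => K) (polyCurve b A r)).comp
      (regularFunctions K V).val
  have hres (f) : res f ∈ ev.range := by
    obtain ⟨f, hf⟩ := f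
    induction hf using Algebra.adjoin_induction with
    | mem f hf =>
      obtain ⟨φ, v, rfl⟩ := hf
      refine ⟨∑ i, ∑ j, C (φ (b i)) * (A i j * C (b.repr v j)), funext fun r => ?_⟩
      change aeval r _ = φ (natRep K V (polyCurve b A r) v)
      rw [apply_natRep_eq_sum b]
      simp [polyCurve, aeval_def]
    | algebraMap c => exact ⟨C c, funext fun r => aeval_C _ _⟩
    | add f g hf hg h1 h2 => exact add_mem h1 h2
    | mul f g hf hg h1 h2 => exact mul_mem h1 h2
  refine ⟨(AlgEquiv.ofInjective ev hev).symm.toAlgHom.comp (res.codRestrict ev.range hres),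
    fun f r => ?_⟩
  have h1 := congrArg Subtype.val
    ((AlgEquiv.ofInjective ev hev).apply_symm_apply (res.codRestrict ev.range hres f))
  have h2 := congrFun h1 r
  change aeval r _ = f.1 (polyCurve b A r) at h2
  rw [coe_aeval_eq_eval] at h2
  exact h2

end Curves

/-! ### Tangent vectors at the identity and uniqueness of differentials. -/

section TangentVectors

variable {K V : Type*} [Field K] [AddCommGroup V] [Module K V]

/-- The Leibniz rule determines a point derivation from its values on algebra generators. Thus `e`
fixes the tangent vector, and differentials are unique. -/
theorem IsTangentVector.ext {δ δ' : regularFunctions K V →ₗ[K] K} (h : IsTangentVector δ)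
    (h' : IsTangentVector δ')
    (heq : ∀ (φ : Dual K V) (v : V), δ ⟨_, matrixCoeff_mem φ v⟩ = δ' ⟨_, matrixCoeff_mem φ v⟩) :
    δ = δ' := by
  have hone {δ : regularFunctions K V →ₗ[K] K} (h : IsTangentVector δ) : δ 1 = 0 := by
    have := h 1 1
    simpa using this
  refine LinearMap.ext fun ⟨f, hf⟩ => ?_
  induction hf using Algebra.adjoin_induction with
  | mem f hf =>
    obtain ⟨φ, v, rfl⟩ := hf
    exact heq φ v
  | algebraMap c =>
    have : (⟨_, Subalgebra.algebraMap_mem _ c⟩ : regularFunctions K V) = c • 1 :=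
      Subtype.ext (Algebra.algebraMap_eq_smul_one c)
    rw [this, map_smul, map_smul, hone h, hone h']
  | add f g hf hg h1 h2 =>
    have : (⟨f + g, add_mem hf hg⟩ : regularFunctions K V) = ⟨f, hf⟩ + ⟨g, hg⟩ := rfl
    rw [this, map_add, map_add, h1, h2]
  | mul f g hf hg h1 h2 =>
    have : (⟨f * g, mul_mem hf hg⟩ : regularFunctions K V) = ⟨f, hf⟩ * ⟨g, hg⟩ := rfl
    rw [this, h, h', h1, h2]

theorem IsDifferential.unique {W : Type*} [AddCommGroup W] [Module K W]
    {ρ : Representation K (SpecialLinearGroup K V) W} {e : sl K V} {D D' : End K W}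
    (h : IsDifferential ρ e D) (h' : IsDifferential ρ e D') : D' = D := by
  obtain ⟨δ, h1, h2, h3⟩ := h
  obtain ⟨δ', h1', h2', h3'⟩ := h'
  obtain rfl : δ = δ' := h1.ext h1' fun φ v => by
    obtain ⟨_, h4⟩ := h2 φ v
    obtain ⟨_, h4'⟩ := h2' φ v
    exact h4.symm.trans h4'
  refine LinearMap.ext fun w => ?_
  rw [← sub_eq_zero, ← Module.forall_dual_apply_eq_zero_iff K]
  intro ψ
  obtain ⟨_, h5⟩ := h3 ψ w
  obtain ⟨_, h5'⟩ := h3' ψ w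
  rw [map_sub, h5', h5, sub_self]

/-- The tangent vector at the identity of a polynomial curve. -/
theorem exists_isTangentVector [Infinite K] {ι : Type*} [Fintype ι] [DecidableEq ι]
    (b : Basis ι K V) (A : Matrix.SpecialLinearGroup ι K[X]) (hA : polyCurve b A 0 = 1) :
    ∃ δ : regularFunctions K V →ₗ[K] K, IsTangentVector δ ∧
      ∀ (f : regularFunctions K V) (P : K[X]), (∀ r, f.1 (polyCurve b A r) = P.eval r) →
        δ f = P.coeff 1 := by
  obtain ⟨Φ, hΦ⟩ := exists_polyCurve_pullback b A
  refine ⟨(lcoeff K 1) ∘ₗ Φ.toLinearMap, fun f g => ?_, fun f P hP => ?_⟩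
  · have h0 (f) : (Φ f).coeff 0 = f.1 1 := by rw [coeff_zero_eq_eval_zero, hΦ, hA]
    change (Φ (f * g)).coeff 1 = f.1 1 * (Φ g).coeff 1 + g.1 1 * (Φ f).coeff 1
    rw [map_mul, mul_coeff_one, h0, h0]
    ring
  · change (Φ f).coeff 1 = _
    rw [show Φ f = P from funext fun r => by rw [hΦ, hP]]

/-- The matrix is unipotent over K[X], so its determinant is a unit there, i.e. a constant; at X = 0
it is 1. -/
theorem det_one_add_smul_of_isNilpotent {ι : Type*} [Fintype ι] [DecidableEq ι]
    {E : Matrix ι ι K} (hE : IsNilpotent E) :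
    (1 + (X : K[X]) • E.map C).det = 1 := by
  have hn : IsNilpotent ((X : K[X]) • E.map C) := by
    obtain ⟨k, hk⟩ := hE
    refine ⟨k, ?_⟩
    have : E.map C = (C : K →+* K[X]).mapMatrix E := rfl
    rw [_root_.smul_pow, this, ← map_pow, hk, map_zero, smul_zero]
  have hu : IsUnit (1 + (X : K[X]) • E.map C).det :=
    (Matrix.isUnit_iff_isUnit_det _).1 hn.isUnit_one_add
  obtain ⟨c, -, hc⟩ := Polynomial.isUnit_iff.1 hu
  have h0 : (1 + (X : K[X]) • E.map C).det.eval 0 = 1 := by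
    rw [eval_det]
    simp
  rw [← hc, eval_C] at h0
  rw [← hc, h0, C_1]

end TangentVectors

end JordanSL

namespace JordanSL

open Module Polynomial

/-! ### Rationality of 𝔭𝔰𝔩(V) and its differential. -/

section RationalPSL

variable {K V : Type*} [Field K] [AddCommGroup V] [Module K V]

theorem matrixEntry_mem {ι : Type*} [Fintype ι] [DecidableEq ι] (b : Basis ι K V) (i j : ι) :
    (fun g => (slOfMatrix b).symm g i j) ∈ regularFunctions K V := by
  refine (congrArg (· ∈ regularFunctions K V) (funext fun g => ?_)).mpr
    (matrixCoeff_mem (b.coord i) (b j))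
  rw [← toMatrix_natRep, LinearMap.toMatrix_apply]
  rfl

theorem matrixEntry_inv_mem {ι : Type*} [Fintype ι] [DecidableEq ι] (b : Basis ι K V) (i j : ι) :
    (fun g => (slOfMatrix b).symm g⁻¹ i j) ∈ regularFunctions K V := by
  have h : (fun g => (slOfMatrix b).symm g⁻¹ i j) =
      ∑ σ : Equiv.Perm ι, (Equiv.Perm.sign σ : ℤ) • ∏ k, fun g => Matrix.updateRow
        ((slOfMatrix b).symm g : Matrix ι ι K) j (Pi.single i 1) (σ k) k := by
    funext g
    -- As the determinant is 1, the inverse is the adjugate, whose entries are polynomial in those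
    -- of g.
    rw [map_inv, Matrix.SpecialLinearGroup.coe_inv, Matrix.adjugate_apply, Matrix.det_apply,
      Finset.sum_apply]
    refine Finset.sum_congr rfl fun σ _ => ?_
    rw [Pi.smul_apply, Finset.prod_apply]
    rfl
  rw [h]
  refine sum_mem fun σ _ => zsmul_mem (prod_mem fun k _ => ?_) _
  by_cases hk : σ k = j
  · simp only [hk, Matrix.updateRow_self]
    exact Subalgebra.algebraMap_mem (regularFunctions K V) ((Pi.single i 1 : ι → K) k)
  · simp only [Matrix.updateRow_ne hk]
    exact matrixEntry_mem b _ _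

/-- A linear form on `𝔭𝔰𝔩(V)` is the restriction of a linear form on `𝔤𝔩(V)`. -/
theorem exists_dual_gl_of_dual_psl (ψ : Dual K (psl K V)) :
    ∃ ψ' : Dual K (End K V), ∀ x : sl K V, ψ (Submodule.Quotient.mk x) = ψ' x := by
  obtain ⟨ψ', h⟩ := LinearMap.exists_extend (p := (sl K V).toSubmodule)
    (ψ ∘ₗ (LieAlgebra.center K (sl K V)).toSubmodule.mkQ)
  exact ⟨ψ', fun x => (LinearMap.congr_fun h x).symm⟩

theorem pslRep_mk (g : SpecialLinearGroup K V) (x : sl K V) :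
    pslRep K V g (Submodule.Quotient.mk x) = Submodule.Quotient.mk (slRep K V g x) := rfl

theorem pslAct_mk (e x : sl K V) :
    pslAct e (Submodule.Quotient.mk x) = Submodule.Quotient.mk (slAct e x) := rfl

variable [FiniteDimensional K V]

theorem glRep_matrixCoeff_mem (ψ : Dual K (End K V)) (x : End K V) :
    (fun g => ψ (glRep K V g x)) ∈ regularFunctions K V := by
  classical
  let b := Free.chooseBasis K V
  have h (g) : ψ (glRep K V g x) = ∑ i, ∑ j, ∑ l, ∑ k, ψ (Matrix.toLin b b (Matrix.single i j 1)) *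
      (((slOfMatrix b).symm g i k * LinearMap.toMatrix b b x k l) *
        (slOfMatrix b).symm g⁻¹ l j) := by
    conv_lhs => rw [← Matrix.toLin_toMatrix b b (glRep K V g x), Matrix.matrix_eq_sum_single
      (LinearMap.toMatrix b b (glRep K V g x))]
    simp only [map_sum]
    refine Finset.sum_congr rfl fun i _ => Finset.sum_congr rfl fun j _ => ?_
    rw [← mul_one (LinearMap.toMatrix b b _ i j), ← smul_eq_mul, ← Matrix.smul_single, map_smul,
      map_smul, smul_eq_mul, glRep_apply, LinearMap.toMatrix_mul, LinearMap.toMatrix_mul,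
      toMatrix_natRep, toMatrix_natRep, mul_comm, Matrix.mul_apply, Finset.mul_sum]
    refine Finset.sum_congr rfl fun l _ => ?_
    rw [Matrix.mul_apply, Finset.sum_mul, Finset.mul_sum]
  have h2 : (fun g => ψ (glRep K V g x)) = ∑ i, ∑ j, ∑ l, ∑ k,
      ψ (Matrix.toLin b b (Matrix.single i j 1)) • (((fun g => (slOfMatrix b).symm g i k) *
        algebraMap K _ (LinearMap.toMatrix b b x k l)) * fun g => (slOfMatrix b).symm g⁻¹ l j) := by
    funext g
    rw [h]
    simp [Finset.sum_apply]
  rw [h2]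
  exact sum_mem fun i _ => sum_mem fun j _ => sum_mem fun l _ => sum_mem fun k _ =>
    Subalgebra.smul_mem _ (mul_mem (mul_mem (matrixEntry_mem b _ _)
      (Subalgebra.algebraMap_mem _ _)) (matrixEntry_inv_mem b _ _)) _

theorem isRational_pslRep : IsRational (pslRep K V) := by
  refine ⟨inferInstanceAs (FiniteDimensional K
    (sl K V ⧸ (LieAlgebra.center K (sl K V)).toSubmodule)), fun ψ w => ?_⟩
  obtain ⟨ψ', hψ⟩ := exists_dual_gl_of_dual_psl ψ
  obtain ⟨x, rfl⟩ := Submodule.Quotient.mk_surjective _ w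
  refine (congrArg (· ∈ regularFunctions K V) (funext fun g => ?_)).mpr
    (glRep_matrixCoeff_mem ψ' (x : End K V))
  exact (congrArg ψ (pslRep_mk g x)).trans (hψ _)

/-- Along g = 1 + re one has gxg⁻¹ = x + r[e, x]g⁻¹, and g⁻¹ is a finite geometric sum since e is
nilpotent. The coefficient of r is [e, x]. -/
theorem isDifferential_pslRep [Infinite K] {e : sl K V} (he : IsNilpotent (e : End K V)) :
    IsDifferential (pslRep K V) e (pslAct e) := by
  classical
  let b := Free.chooseBasis K V
  have hE : IsNilpotent (LinearMap.toMatrix b b (e : End K V)) :=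
    he.map (LinearMap.toMatrixAlgEquiv b)
  let A : Matrix.SpecialLinearGroup _ K[X] := ⟨_, det_one_add_smul_of_isNilpotent hE⟩
  have hA (r : K) : natRep K V (polyCurve b A r) = 1 + r • (e : End K V) := by
    refine (LinearMap.toMatrix b b).injective ?_
    rw [toMatrix_natRep, polyCurve, MulEquiv.symm_apply_apply, map_add, map_smul,
      LinearMap.toMatrix_one]
    ext i j
    change eval r ((1 + (X : K[X]) • (LinearMap.toMatrix b b (e : End K V)).map C :
      Matrix _ _ K[X]) i j) = _
    rw [Matrix.add_apply, Matrix.smul_apply, Matrix.map_apply, eval_add, smul_eq_mul, eval_mul,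
      eval_X, eval_C, Matrix.one_apply, Matrix.add_apply, Matrix.one_apply]
    split_ifs <;> simp
  have hA0 : polyCurve b A 0 = 1 := by
    refine (slOfMatrix b).symm.injective (Subtype.ext ?_)
    rw [← toMatrix_natRep, hA, zero_smul, add_zero, LinearMap.toMatrix_one, map_one]
    rfl
  obtain ⟨δ, hδ, hδ'⟩ := exists_isTangentVector b A hA0
  refine ⟨δ, hδ, fun φ v => ⟨matrixCoeff_mem φ v, ?_⟩, fun ψ w => ⟨isRational_pslRep.2 ψ w, ?_⟩⟩
  · rw [hδ' _ (C (φ v) + X * C (φ ((e : End K V) v)))]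
    · simp [coeff_C]
    · intro r
      change φ (natRep K V (polyCurve b A r) v) = _
      rw [hA]
      simp
      ring
  · obtain ⟨ψ', hψ⟩ := exists_dual_gl_of_dual_psl ψ
    obtain ⟨x, rfl⟩ := Submodule.Quotient.mk_surjective _ w
    obtain ⟨N, hN⟩ := he
    -- Summing up to N rather than N − 1 keeps the k = 0 term, which carries the linear coefficient,
    -- even when N = 0.
    have hinv (r : K) : natRep K V (polyCurve b A r)⁻¹ =
        ∑ k ∈ Finset.range (N + 1), (-(r • (e : End K V))) ^ k := by
      have h1 : natRep K V (polyCurve b A r) *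
          ∑ k ∈ Finset.range (N + 1), (-(r • (e : End K V))) ^ k = 1 := by
        have := mul_neg_geom_sum (-(r • (e : End K V))) (N + 1)
        rw [sub_neg_eq_add, ← smul_neg, _root_.smul_pow, pow_succ (-(e : End K V)), neg_pow, hN,
          mul_zero, zero_mul, smul_zero, sub_zero] at this
        rw [hA, ← smul_neg]
        exact this
      calc _ = natRep K V (polyCurve b A r)⁻¹ * (natRep K V (polyCurve b A r) *
          ∑ k ∈ Finset.range (N + 1), (-(r • (e : End K V))) ^ k) := by rw [h1, mul_one]
        _ = _ := by rw [← mul_assoc, natRep_inv_mul, one_mul]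
    rw [hδ' _ (C (ψ' x) + X * ∑ k ∈ Finset.range (N + 1), (-X) ^ k *
      C (ψ' (glAct e (x : End K V) * (e : End K V) ^ k)))]
    · rw [coeff_add, coeff_C, if_neg one_ne_zero, zero_add, coeff_X_mul, finsetSum_coeff,
        Finset.sum_eq_single 0]
      · rw [pow_zero, pow_zero, one_mul, mul_one, coeff_C, if_pos rfl]
        exact (congrArg ψ (pslAct_mk e x)).trans (hψ _)
      · intro k _ hk
        rw [coeff_mul_C, coeff_zero_eq_eval_zero]
        simp [hk]
      · simp
    · intro r
      refine (congrArg ψ (pslRep_mk (polyCurve b A r) x)).trans ((hψ _).trans ?_)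
      change ψ' (glRep K V (polyCurve b A r) (x : End K V)) = _
      have h2 : glRep K V (polyCurve b A r) (x : End K V) =
          x + r • (glAct e (x : End K V) * natRep K V (polyCurve b A r)⁻¹) := by
        have h3 := natRep_mul_inv (polyCurve b A r)
        rw [glRep_apply, glAct_apply]
        have h4 : (x : End K V) = x * natRep K V (polyCurve b A r) *
          natRep K V (polyCurve b A r)⁻¹ := by rw [mul_assoc, h3, mul_one]
        nth_rewrite 2 [h4]
        rw [hA, ← smul_mul_assoc, ← add_mul]
        congr 1
        simp only [add_mul, mul_add, one_mul, mul_one, smul_mul_assoc, mul_smul_comm, smul_sub]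
        abel
      rw [h2, hinv, map_add, map_smul, Finset.mul_sum, map_sum]
      simp only [eval_add, eval_C, eval_mul, eval_X, eval_finsetSum, eval_pow, eval_neg,
        smul_eq_mul]
      congr 2
      refine Finset.sum_congr rfl fun k _ => ?_
      rw [← neg_smul, _root_.smul_pow, mul_smul_comm, map_smul, smul_eq_mul]

end RationalPSL

end JordanSL

namespace JordanSL

/-! ### Matrix spaces stable under conjugation by transvections. -/

section TransvectionStable

open Matrix

variable {K : Type*} [Field K] {ι : Type*} [Fintype ι] [DecidableEq ι]

theorem single_mul_mul_single (i j k l : ι) (M : Matrix ι ι K) :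
    single i j 1 * M * single k l 1 = M j k • single i l 1 := by
  ext a c
  rw [mul_apply, Finset.sum_eq_single k]
  · by_cases ha : i = a
    · subst ha
      by_cases hc : l = c
      · subst hc; simp
      · simp [hc]
    · rw [Matrix.smul_apply, single_apply_of_row_ne ha, smul_zero]
      rw [single_mul_apply_of_ne _ _ _ _ _ (Ne.symm ha), zero_mul]
  · intro x _ hx
    rw [single_apply_of_row_ne (Ne.symm hx), mul_zero]
  · simp

/-- A space of matrices that is stable under conjugation by transvections and contains a matrix that
is not scalar contains all matrices of trace zero. -/
theorem mem_of_transvection_stable [Infinite K] (N : Submodule K (Matrix ι ι K))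
    (hN : ∀ i j, i ≠ j → ∀ (a : K), ∀ M ∈ N, transvection i j a * M * transvection i j (-a) ∈ N)
    {M₀ : Matrix ι ι K} (hM₀ : M₀ ∈ N) (hM₀' : M₀ ∉ Set.range (scalar ι))
    {M : Matrix ι ι K} (hM : M.trace = 0) : M ∈ N := by
  have hexp (i j : ι) (a : K) (M : Matrix ι ι K) :
      transvection i j a * M * transvection i j (-a) =
        M + a • (single i j 1 * M - M * single i j 1) - (a * a) • (M j i • single i j 1) := by
    have h1 (a : K) : transvection i j a = 1 + a • single i j 1 := by
      rw [transvection, smul_single, smul_eq_mul, mul_one]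
    rw [h1, h1, ← single_mul_mul_single]
    simp only [add_mul, mul_add, one_mul, mul_one, smul_mul_assoc, mul_smul_comm, smul_sub,
      neg_smul, mul_neg]
    module
  classical
  -- Comparing the parameters 1 and c separates the linear and quadratic parts of `hexp`, because c²
  -- − c ≠ 0.
  obtain ⟨c, hc⟩ := Infinite.exists_notMem_finset ({0, 1} : Finset K)
  simp only [Finset.mem_insert, Finset.mem_singleton, not_or] at hc
  have hstep {i j : ι} (hij : i ≠ j) {M : Matrix ι ι K} (hM : M ∈ N) :
      M j i • single i j 1 ∈ N ∧ single i j 1 * M - M * single i j 1 ∈ N := by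
    have h1 (a : K) : a • (single i j 1 * M - M * single i j 1) -
        (a * a) • (M j i • single i j 1) ∈ N := by
      have := N.sub_mem (hN i j hij a M hM) hM
      rwa [hexp, add_sub_assoc, add_sub_cancel_left] at this
    have h2 : M j i • single i j 1 ∈ N := by
      have h3 := N.sub_mem (N.smul_mem c (h1 1)) (h1 c)
      have h4 : c * c - c ≠ 0 := by
        rw [← mul_sub_one]
        exact mul_ne_zero hc.1 (sub_ne_zero.2 hc.2)
      rw [← N.smul_mem_iff h4]
      convert h3 using 1
      module
    refine ⟨h2, ?_⟩
    have h3 := N.add_mem (h1 1) h2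
    convert h3 using 1
    module
  have hsingle {i j : ι} (hij : i ≠ j) {M : Matrix ι ι K} (hM : M ∈ N) (h : M j i ≠ 0) :
      single i j 1 ∈ N := (N.smul_mem_iff h).1 (hstep hij hM).1
  -- A nonzero off-diagonal entry of `M₀` yields a matrix unit through the quadratic part; a
  -- diagonal non-scalar `M₀` yields one through the bracket.
  obtain ⟨i, j, hij, h1⟩ : ∃ i j, i ≠ j ∧ (single i j 1 : Matrix ι ι K) ∈ N := by
    rw [mem_range_scalar_iff_commute_single] at hM₀'
    push Not at hM₀'
    obtain ⟨i, j, hij, hne⟩ := hM₀'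
    by_cases hoff : ∃ k l, k ≠ l ∧ M₀ l k ≠ 0
    · obtain ⟨k, l, hkl, h⟩ := hoff
      exact ⟨k, l, hkl, hsingle hkl hM₀ h⟩
    · push Not at hoff
      have hdiag : M₀ = diagonal fun i => M₀ i i := by
        ext k l
        by_cases hkl : k = l
        · subst hkl; simp
        · rw [diagonal_apply_ne _ hkl, hoff l k (Ne.symm hkl)]
      have h2 : single i j 1 * M₀ - M₀ * single i j 1 = (M₀ j j - M₀ i i) • single i j 1 := by
        rw [hdiag]
        ext k l
        simp only [Matrix.sub_apply, mul_diagonal, diagonal_mul, Matrix.smul_apply, single_apply, smul_eq_mul,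
          diagonal_apply_eq]
        split_ifs with h
        · obtain ⟨rfl, rfl⟩ := h
          ring
        · ring
      have h3 := (hstep hij hM₀).2
      have h4 : M₀ j j - M₀ i i ≠ 0 := by
        intro h0
        rw [h0, zero_smul, sub_eq_zero] at h2
        exact hne h2
      rw [h2] at h3
      exact ⟨i, j, hij, (N.smul_mem_iff h4).1 h3⟩
  have hswap {i j : ι} (hij : i ≠ j) (h : (single i j 1 : Matrix ι ι K) ∈ N) :
      (single j i 1 : Matrix ι ι K) ∈ N := hsingle hij.symm h (by simp)
  have hrow {i j k : ι} (hij : i ≠ j) (hkj : k ≠ j) (h : (single i j 1 : Matrix ι ι K) ∈ N) :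
      (single k j 1 : Matrix ι ι K) ∈ N := by
    by_cases hki : k = i
    · rwa [hki]
    · have h2 := (hstep hki h).2
      rwa [single_mul_single_same, single_mul_single_of_ne _ _ _ _ hkj.symm, sub_zero, mul_one]
        at h2
  have hoff {k l : ι} (hkl : k ≠ l) : (single k l 1 : Matrix ι ι K) ∈ N := by
    by_cases hlj : l = j
    · subst hlj
      exact hrow hij hkl h1
    · have h2 := hswap (Ne.symm (Ne.symm hlj)) (hrow hij hlj h1)
      exact hswap hkl.symm (by
        by_cases hkj : k = j
        · subst hkj; exact hrow hij hlj h1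
        · exact hswap hkl (hrow (Ne.symm hlj) hkl h2))
  have hdiag (k : ι) : (single k k 1 - single i i 1 : Matrix ι ι K) ∈ N := by
    by_cases hki : k = i
    · rw [hki, sub_self]
      exact N.zero_mem
    · have h2 := (hstep hki (hoff (Ne.symm hki))).2
      rwa [single_mul_single_same, single_mul_single_same, mul_one] at h2
  -- The corrections along E_{ii} add up to the trace of `M`, which is zero.
  have hsum : M = ∑ k, ∑ l, M k l • (single k l 1 - if k = l then single i i 1 else 0) := by
    simp only [smul_sub, Finset.sum_sub_distrib, smul_ite, smul_zero, Finset.sum_ite_eq,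
      Finset.mem_univ, if_true, ← Finset.sum_smul]
    have h5 : ∑ k, M k k = 0 := hM
    rw [h5, zero_smul, sub_zero]
    conv_lhs => rw [matrix_eq_sum_single M]
    simp [smul_single]
  rw [hsum]
  refine sum_mem fun k _ => sum_mem fun l _ => N.smul_mem _ ?_
  split_ifs with h
  · subst h
    exact hdiag k
  · rw [sub_zero]
    exact hoff h

end TransvectionStable

/-! ### Irreducibility of 𝔭𝔰𝔩(V). -/

section Irreducibility

open Module

variable {K V : Type*} [Field K] [AddCommGroup V] [Module K V]

theorem toMatrix_glRep {ι : Type*} [Fintype ι] [DecidableEq ι] (b : Basis ι K V)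
    (A : Matrix.SpecialLinearGroup ι K) (x : End K V) :
    LinearMap.toMatrix b b (glRep K V (slOfMatrix b A) x) =
      A * LinearMap.toMatrix b b x * (A⁻¹ : Matrix.SpecialLinearGroup ι K) := by
  rw [glRep_apply, LinearMap.toMatrix_mul, LinearMap.toMatrix_mul, toMatrix_natRep,
    toMatrix_natRep, ← map_inv, MulEquiv.symm_apply_apply, MulEquiv.symm_apply_apply]

theorem isIrreducible_of_forall {G W : Type*} [Group G] [AddCommGroup W] [Module K W] [Nontrivial W]
    (ρ : Representation K G W)
    (h : ∀ P : Submodule K W, (∀ g, ∀ w ∈ P, ρ g w ∈ P) → P ≠ ⊥ → P = ⊤) : ρ.IsIrreducible where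
  exists_pair_ne := ⟨⊥, ⊤, fun h => bot_ne_top (α := Submodule K W)
    (congrArg Subrepresentation.toSubmodule h)⟩
  eq_bot_or_eq_top P := by
    by_cases hP : P.toSubmodule = ⊥
    · exact Or.inl (Subrepresentation.toSubmodule_injective hP)
    · exact Or.inr (Subrepresentation.toSubmodule_injective
        (h P.toSubmodule (fun g _ hw => P.apply_mem_toSubmodule g hw) hP))

theorem eq_bot_or_eq_top_of_isIrreducible {G W : Type*} [Group G] [AddCommGroup W] [Module K W]
    {ρ : Representation K G W} (hρ : ρ.IsIrreducible) (P : Submodule K W)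
    (h : ∀ g, ∀ w ∈ P, ρ g w ∈ P) : P = ⊥ ∨ P = ⊤ := by
  rcases hρ.eq_bot_or_eq_top ⟨P, fun g _ hw => h g _ hw⟩ with h | h
  · exact Or.inl (congrArg Subrepresentation.toSubmodule h)
  · exact Or.inr (congrArg Subrepresentation.toSubmodule h)

variable [FiniteDimensional K V] {ι : Type*} [Fintype ι] [DecidableEq ι]

theorem toLin_single_notMem_center (b : Basis ι K V) {i j : ι} (hij : i ≠ j) :
    (⟨_, toLin_single_mem_sl b hij 1⟩ : sl K V) ∉ LieAlgebra.center K (sl K V) := by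
  rw [mem_center_sl_iff]
  rintro ⟨c, hc⟩
  have h := congrArg (LinearMap.toMatrix b b) hc
  rw [LinearMap.toMatrix_toLin, map_smul, LinearMap.toMatrix_one] at h
  have h2 := congrFun (congrFun h i) j
  simp [hij] at h2

theorem isIrreducible_pslRep [Infinite K] [Nontrivial ι] (b : Basis ι K V) :
    (pslRep K V).IsIrreducible := by
  obtain ⟨i, j, hij⟩ := exists_pair_ne ι
  have : Nontrivial (psl K V) := ⟨⟨Submodule.Quotient.mk ⟨_, toLin_single_mem_sl b hij 1⟩, 0,
    fun h => toLin_single_notMem_center b hij ((Submodule.Quotient.mk_eq_zero _).1 h)⟩⟩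
  refine isIrreducible_of_forall _ fun P hP hbot => ?_
  obtain ⟨w, hw, hw0⟩ := (Submodule.ne_bot_iff _).1 hbot
  obtain ⟨x₀, rfl⟩ := Submodule.Quotient.mk_surjective _ w
  let T : sl K V →ₗ[K] Matrix ι ι K :=
    (LinearMap.toMatrix b b).toLinearMap ∘ₗ (sl K V).toSubmodule.subtype
  have hT : Function.Injective T := (LinearMap.toMatrix b b).injective.comp Subtype.val_injective
  let N : Submodule K (Matrix ι ι K) :=
    (P.comap (LieAlgebra.center K (sl K V)).toSubmodule.mkQ).map T
  refine (Submodule.eq_top_iff').2 fun w => ?_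
  obtain ⟨x, rfl⟩ := Submodule.Quotient.mk_surjective _ w
  have hx : T x ∈ N := by
    refine mem_of_transvection_stable N ?_ (M₀ := T x₀) ⟨x₀, hw, rfl⟩ ?_ ?_
    · rintro i j hij a _ ⟨y, hy, rfl⟩
      let A : Matrix.SpecialLinearGroup ι K :=
        ⟨Matrix.transvection i j a, Matrix.det_transvection_of_ne i j hij a⟩
      let B : Matrix.SpecialLinearGroup ι K :=
        ⟨Matrix.transvection i j (-a), Matrix.det_transvection_of_ne i j hij (-a)⟩
      have hAB : A⁻¹ = B := inv_eq_of_mul_eq_one_right (Subtype.ext (by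
        change Matrix.transvection i j a * Matrix.transvection i j (-a) = 1
        rw [Matrix.transvection_mul_transvection_same _ _ hij, add_neg_cancel,
          Matrix.transvection_zero]))
      refine ⟨slRep K V (slOfMatrix b A) y, hP (slOfMatrix b A) _ hy, ?_⟩
      refine (toMatrix_glRep b A (y : End K V)).trans ?_
      rw [hAB]
      rfl
    · rintro ⟨c, hc⟩
      refine hw0 ((Submodule.Quotient.mk_eq_zero _).2 (mem_center_sl_iff.2 ⟨c, ?_⟩))
      refine (LinearMap.toMatrix b b).injective ?_
      rw [map_smul, LinearMap.toMatrix_one, Matrix.smul_one_eq_diagonal, ← Matrix.scalar_apply]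
      exact hc.symm
    · change (LinearMap.toMatrix b b (x : End K V)).trace = 0
      rw [← LinearMap.trace_eq_matrix_trace]
      exact x.2
  obtain ⟨y, hy, hyx⟩ := hx
  rw [← hT hyx]
  exact hy

end Irreducibility

/-! ### The highest weight of 𝔭𝔰𝔩(V). -/

section HighestWeight

open Module

variable {K V : Type*} [Field K] [AddCommGroup V] [Module K V] {n : ℕ}

theorem toLin_single_apply {ι : Type*} [Fintype ι] [DecidableEq ι] (b : Basis ι K V) (i j : ι)
    (v : V) : Matrix.toLin b b (Matrix.single i j 1) v = b.coord j v • b i := by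
  have h : Matrix.toLin b b (Matrix.single i j 1) = (b.coord j).smulRight (b i) := by
    refine b.ext fun k => ?_
    rw [Matrix.toLin_self, LinearMap.smulRight_apply, Basis.coord_apply, Basis.repr_self,
      Finset.sum_eq_single i]
    · congr 1
      simp [Matrix.single_apply, Finsupp.single_apply, eq_comm]
    · intro l _ hl
      rw [Matrix.single_apply_of_row_ne (Ne.symm hl), zero_smul]
    · simp
  rw [h, LinearMap.smulRight_apply]

theorem prod_eq_one_of_isDiagonal {b : Basis (Fin n) K V} {g : SpecialLinearGroup K V}
    {s : Fin n → K} (h : IsDiagonal b g s) : ∏ i, s i = 1 := by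
  have h1 : LinearMap.toMatrix b b (natRep K V g) = Matrix.diagonal s := by
    ext i j
    rw [LinearMap.toMatrix_apply, natRep_apply, h j, map_smul, Finsupp.smul_apply,
      Basis.repr_self, Finsupp.single_apply, Matrix.diagonal_apply]
    by_cases hij : j = i
    · subst hij; simp
    · simp [hij, Ne.symm hij]
  have h2 := ((slOfMatrix b).symm g).det_coe
  rwa [← toMatrix_natRep, h1, Matrix.det_diagonal] at h2

theorem fundamentalWeight_one (hn : 0 < n) (s : Fin n → K) :
    fundamentalWeight 1 s = s ⟨0, hn⟩ := by
  rw [fundamentalWeight, show Finset.univ.filter (fun j : Fin n => (j : ℕ) < 1) = {⟨0, hn⟩} by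
    ext j; simp [Fin.ext_iff], Finset.prod_singleton]

theorem fundamentalWeight_sub_one_mul (hn : 0 < n) (s : Fin n → K) :
    fundamentalWeight (n - 1) s * s ⟨n - 1, by omega⟩ = ∏ i, s i := by
  rw [fundamentalWeight, show Finset.univ.filter (fun j : Fin n => (j : ℕ) < n - 1) =
    Finset.univ.erase ⟨n - 1, by omega⟩ by ext j; simp [Fin.ext_iff]; omega,
    Finset.prod_erase_mul _ _ (Finset.mem_univ _)]

/-- The highest weight vector is the class of the corner matrix unit. Its weight s_0/s_{n−1} equals
s_0·(s_0⋯s_{n−2}) because the product of all s_i is 1. -/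
theorem isAdjointSimple_pslRep [FiniteDimensional K V] [Infinite K] (hn : 2 ≤ n)
    (b : Basis (Fin n) K V) : IsAdjointSimple b (pslRep K V) := by
  have : Nontrivial (Fin n) := Fin.nontrivial_iff_two_le.2 hn
  let i₀ : Fin n := ⟨0, by omega⟩
  let il : Fin n := ⟨n - 1, by omega⟩
  have hne : i₀ ≠ il := fun h => by have := congrArg Fin.val h; simp [i₀, il] at this; omega
  have hinv (g : SpecialLinearGroup K V) (v : V) : natRep K V g (natRep K V g⁻¹ v) = v := by
    rw [← End.mul_apply, natRep_mul_inv, End.one_apply]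
  refine ⟨isRational_pslRep, isIrreducible_pslRep b,
    Submodule.Quotient.mk ⟨_, toLin_single_mem_sl b hne 1⟩,
    fun h => toLin_single_notMem_center b hne ((Submodule.Quotient.mk_eq_zero _).1 h),
    fun g hg => ?_, fun g s hg => ?_⟩
  · refine (pslRep_mk _ _).trans (congrArg _ (Subtype.ext (LinearMap.ext fun v => ?_)))
    change natRep K V g (Matrix.toLin b b (Matrix.single i₀ il 1) (natRep K V g⁻¹ v)) =
      Matrix.toLin b b (Matrix.single i₀ il 1) v
    have h1 : natRep K V g (b i₀) = b i₀ := by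
      have := hg i₀
      rw [show {j | j < i₀} = (∅ : Set (Fin n)) by
        ext j; simp [i₀, Fin.lt_def], Set.image_empty, Submodule.span_empty,
        Submodule.mem_bot, sub_eq_zero] at this
      exact this
    have h2 : b.coord il ∘ₗ natRep K V g = b.coord il := by
      refine b.ext fun i => ?_
      have h3 : Submodule.span K (b '' {j | j < i}) ≤ LinearMap.ker (b.coord il) := by
        rw [Submodule.span_le]
        rintro _ ⟨j, hj, rfl⟩
        have hj' : j < i := hj
        have : j ≠ il := fun h => by
          rw [h, Fin.lt_def] at hj'; have := i.2; simp [il] at hj'; omega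
        simp [this]
      have h4 := h3 (hg i)
      rw [LinearMap.mem_ker, map_sub, sub_eq_zero] at h4
      exact h4
    rw [toLin_single_apply, toLin_single_apply, map_smul, h1]
    congr 1
    rw [← LinearMap.congr_fun h2 (natRep K V g⁻¹ v), LinearMap.comp_apply, hinv]
  · refine (pslRep_mk _ _).trans ((congrArg _ (Subtype.ext (LinearMap.ext fun v => ?_))).trans
      (Submodule.Quotient.mk_smul _ _ _))
    change natRep K V g (Matrix.toLin b b (Matrix.single i₀ il 1) (natRep K V g⁻¹ v)) =
      (fundamentalWeight 1 s * fundamentalWeight (n - 1) s) •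
        Matrix.toLin b b (Matrix.single i₀ il 1) v
    have h1 : natRep K V g (b i₀) = s i₀ • b i₀ := hg i₀
    have h2 : b.coord il ∘ₗ natRep K V g = s il • b.coord il := by
      refine b.ext fun i => ?_
      rw [LinearMap.comp_apply, natRep_apply, hg i, LinearMap.smul_apply, map_smul]
      by_cases hi : i = il
      · rw [hi]
      · simp [hi]
    have h3 := prod_eq_one_of_isDiagonal hg
    rw [← fundamentalWeight_sub_one_mul (by omega)] at h3
    rw [toLin_single_apply, toLin_single_apply, map_smul, h1, fundamentalWeight_one (by omega),
      smul_smul, smul_smul]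
    congr 1
    have h4 := LinearMap.congr_fun h2 (natRep K V g⁻¹ v)
    rw [LinearMap.comp_apply, hinv, LinearMap.smul_apply, smul_eq_mul] at h4
    rw [h4]
    change _ = s i₀ * _ * (s il * _)
    have h5 : fundamentalWeight (n - 1) s * s il = 1 := h3
    linear_combination (- s i₀ * b.coord il (natRep K V g⁻¹ v)) * h5

end HighestWeight

end JordanSL

namespace JordanSL

open Module Polynomial

/-! ### Density of the big cell and contraction by the torus. -/

section BigCell

variable {K : Type*} [Field K]

/-- Write `M` as transvections times a diagonal matrix times transvections, and multiply every
transvection parameter by X. The curve joins `M` to a point of the big cell. -/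
theorem exists_polynomial_path {ι : Type*} [Fintype ι] [DecidableEq ι] (M : Matrix ι ι K)
    (hM : M.det = 1) :
    ∃ A : Matrix.SpecialLinearGroup ι K[X], (A : Matrix ι ι K[X]).map (eval 1) = M ∧
      ∃ D : ι → K, (A : Matrix ι ι K[X]).map (eval 0) = Matrix.diagonal D := by
  obtain ⟨L, L', D, h⟩ := Matrix.Pivot.exists_list_transvec_mul_diagonal_mul_list_transvec M
  let T : Matrix.TransvectionStruct ι K → Matrix.TransvectionStruct ι K[X] :=
    fun s => ⟨s.i, s.j, s.hij, C s.c * X⟩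
  have hT (r : K) (s : Matrix.TransvectionStruct ι K) :
      (evalRingHom r).mapMatrix (T s).toMatrix = Matrix.transvection s.i s.j (s.c * r) := by
    ext i j
    simp only [T, Matrix.TransvectionStruct.toMatrix, Matrix.transvection, map_add, map_one,
      RingHom.mapMatrix_apply, Matrix.add_apply, Matrix.map_apply, Matrix.single_apply,
      coe_evalRingHom]
    split_ifs <;> simp
  have hprod (r : K) (L : List (Matrix.TransvectionStruct ι K)) :
      (evalRingHom r).mapMatrix ((L.map T).map Matrix.TransvectionStruct.toMatrix).prod =
        (L.map fun s => Matrix.transvection s.i s.j (s.c * r)).prod := by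
    rw [map_list_prod, List.map_map, List.map_map]
    congr 1
    exact List.map_congr_left fun s _ => hT r s
  let B : Matrix ι ι K[X] := ((L.map T).map Matrix.TransvectionStruct.toMatrix).prod *
    (C : K →+* K[X]).mapMatrix (Matrix.diagonal D) *
      ((L'.map T).map Matrix.TransvectionStruct.toMatrix).prod
  have hB (r : K) : (evalRingHom r).mapMatrix B =
      (L.map fun s => Matrix.transvection s.i s.j (s.c * r)).prod * Matrix.diagonal D *
        (L'.map fun s => Matrix.transvection s.i s.j (s.c * r)).prod := by
    rw [map_mul, map_mul, hprod, hprod]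
    congr 2
    rw [RingHom.mapMatrix_apply, RingHom.mapMatrix_apply, Matrix.diagonal_map (map_zero _),
      Matrix.diagonal_map (map_zero _)]
    congr 1
    funext i
    exact eval_C
  refine ⟨⟨B, ?_⟩, (hB 1).trans ?_, D, (hB 0).trans ?_⟩
  · rw [Matrix.det_mul, Matrix.det_mul, Matrix.TransvectionStruct.det_toMatrix_prod,
      Matrix.TransvectionStruct.det_toMatrix_prod, one_mul, mul_one, ← RingHom.map_det]
    have h2 := congrArg Matrix.det h
    rw [Matrix.det_mul, Matrix.det_mul, Matrix.TransvectionStruct.det_toMatrix_prod,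
      Matrix.TransvectionStruct.det_toMatrix_prod, one_mul, mul_one, hM] at h2
    rw [← h2, map_one]
  · rw [h]
    simp only [mul_one]
    rfl
  · simp [Matrix.transvection_zero]

variable {n : ℕ}

/-- The leading principal submatrix with row and column indices less than `j`. -/
def leadingSubmatrix {R : Type*} (M : Matrix (Fin n) (Fin n) R) (j : Fin n) :
    Matrix {i // i < j} {i // i < j} R := M.submatrix Subtype.val Subtype.val

/-- A lower unitriangular matrix. -/
def IsLowerUnitriangular (L : Matrix (Fin n) (Fin n) K) : Prop :=
  (∀ i j, i < j → L i j = 0) ∧ ∀ i, L i i = 1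

/-- Column j of `U` above the diagonal solves a linear system with the j-th leading submatrix,
chosen to kill column j of `M * U` above the diagonal. -/
theorem exists_mul_upper_eq_lower (M : Matrix (Fin n) (Fin n) K)
    (hM : ∀ j, (leadingSubmatrix M j).det ≠ 0) :
    ∃ U : Matrix (Fin n) (Fin n) K, (∀ i j, j < i → U i j = 0) ∧ (∀ i, U i i = 1) ∧
      ∀ i j, i < j → (M * U) i j = 0 := by
  let c (j : Fin n) : {i // i < j} → K :=
    (leadingSubmatrix M j)⁻¹.mulVec fun i : {i // i < j} => - M i j
  have hc (j : Fin n) (i : Fin n) (hi : i < j) :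
      ∑ k : {k // k < j}, M i k * c j k = - M i j := by
    have h1 : (leadingSubmatrix M j).mulVec (c j) = fun i : {i // i < j} => - M i j := by
      simp only [c]
      rw [Matrix.mulVec_mulVec, Matrix.mul_nonsing_inv _ (hM j).isUnit, Matrix.one_mulVec]
    exact congrFun h1 ⟨i, hi⟩
  let U : Matrix (Fin n) (Fin n) K := Matrix.of fun i j =>
    if h : i < j then c j ⟨i, h⟩ else if i = j then 1 else 0
  have hU (i j : Fin n) : U i j = if h : i < j then c j ⟨i, h⟩ else if i = j then 1 else 0 := rfl
  refine ⟨U, fun i j h => ?_, fun i => ?_, fun i j h => ?_⟩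
  · rw [hU, dif_neg (not_lt.2 h.le), if_neg (ne_of_gt h)]
  · simp [hU]
  · have h2 : ∑ k ∈ Finset.univ.filter (· < j), M i k * U k j = - M i j := by
      rw [← hc j i h, Finset.sum_subtype (Finset.univ.filter (· < j)) (p := (· < j)) (by simp)
        (fun k => M i k * U k j)]
      refine Finset.sum_congr rfl fun k _ => ?_
      rw [hU, dif_pos k.2]
    rw [Matrix.mul_apply, ← Finset.sum_filter_add_sum_filter_not _ (· < j), h2,
      Finset.sum_eq_single j]
    · simp [hU]
    · intro k hk hkj
      rw [hU, dif_neg (Finset.mem_filter.1 hk).2, if_neg hkj, mul_zero]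
    · simp

theorem toLin_diagonal_apply {V : Type*} [AddCommGroup V] [Module K V] (b : Basis (Fin n) K V)
    (s : Fin n → K) (i : Fin n) : Matrix.toLin b b (Matrix.diagonal s) (b i) = s i • b i := by
  rw [Matrix.toLin_self, Finset.sum_eq_single i]
  · rw [Matrix.diagonal_apply_eq]
  · intro j _ hj
    rw [Matrix.diagonal_apply_ne _ hj, zero_smul]
  · simp

variable {V : Type*} [AddCommGroup V] [Module K V] (b : Basis (Fin n) K V)

/-- Every element with non-vanishing leading principal minors lies in the big cell. -/
theorem exists_bigCell_decomposition (M : Matrix.SpecialLinearGroup (Fin n) K)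
    (hM : ∀ j, (leadingSubmatrix (M : Matrix (Fin n) (Fin n) K) j).det ≠ 0) :
    ∃ (U T : SpecialLinearGroup K V) (L : Matrix.SpecialLinearGroup (Fin n) K) (s : Fin n → K),
      IsUpperUnitriangular b U ∧ IsDiagonal b T s ∧
      IsLowerUnitriangular (L : Matrix (Fin n) (Fin n) K) ∧
      slOfMatrix b M * U = slOfMatrix b L * T := by
  obtain ⟨U, hU, hU1, hN⟩ := exists_mul_upper_eq_lower (M : Matrix (Fin n) (Fin n) K) hM
  set N := (M : Matrix (Fin n) (Fin n) K) * U with hNdef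
  have hUdet : U.det = 1 := by
    rw [Matrix.det_of_isUpperTriangular (fun i j h => hU i j h)]
    simp [hU1]
  have hNdet : ∏ i, N i i = 1 := by
    rw [← Matrix.det_of_isLowerTriangular N fun i j h => hN i j h, hNdef, Matrix.det_mul, hUdet,
      M.det_coe, one_mul]
  have hNne (i : Fin n) : N i i ≠ 0 := fun h0 =>
    one_ne_zero (hNdet.symm.trans (Finset.prod_eq_zero (Finset.mem_univ i) h0))
  let L : Matrix (Fin n) (Fin n) K := Matrix.of fun i j => N i j / N j j
  have hL : IsLowerUnitriangular L := by
    refine ⟨fun i j h => ?_, fun i => ?_⟩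
    · change N i j / N j j = 0
      rw [hN i j h, zero_div]
    · exact div_self (hNne i)
  have hLdet : L.det = 1 := by
    rw [Matrix.det_of_isLowerTriangular L fun i j h => hL.1 i j h]
    simp [hL.2]
  let s : Fin n → K := fun i => N i i
  let U' : Matrix.SpecialLinearGroup (Fin n) K := ⟨U, hUdet⟩
  let L' : Matrix.SpecialLinearGroup (Fin n) K := ⟨L, hLdet⟩
  let T' : Matrix.SpecialLinearGroup (Fin n) K :=
    ⟨Matrix.diagonal s, by rw [Matrix.det_diagonal]; exact hNdet⟩
  refine ⟨slOfMatrix b U', slOfMatrix b T', L', s, fun i => ?_, fun i => ?_, hL, ?_⟩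
  · change Matrix.toLin b b U (b i) - b i ∈ _
    rw [Matrix.toLin_self, ← Finset.sum_erase_add _ _ (Finset.mem_univ i), hU1, one_smul,
      add_sub_cancel_right]
    refine sum_mem fun j hj => ?_
    rcases lt_or_gt_of_ne (Finset.ne_of_mem_erase hj) with h | h
    · exact Submodule.smul_mem _ _ (Submodule.subset_span ⟨j, h, rfl⟩)
    · rw [hU j i h, zero_smul]
      exact zero_mem _
  · exact toLin_diagonal_apply b s i
  · rw [← map_mul, ← map_mul]
    congr 1
    refine Subtype.ext ?_
    change N = L * Matrix.diagonal s
    ext i j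
    rw [Matrix.mul_diagonal]
    exact (div_mul_cancel₀ _ (hNne j)).symm

/-- The big cell is dense. -/
theorem eq_zero_of_eq_zero_on_bigCell [Infinite K] {f : SpecialLinearGroup K V → K}
    (hf : f ∈ regularFunctions K V)
    (h : ∀ M : Matrix.SpecialLinearGroup (Fin n) K,
      (∀ j, (leadingSubmatrix (M : Matrix (Fin n) (Fin n) K) j).det ≠ 0) →
      f (slOfMatrix b M) = 0) (g : SpecialLinearGroup K V) : f g = 0 := by
  obtain ⟨M, rfl⟩ := (slOfMatrix b).surjective g
  obtain ⟨A, hA1, D, hA0⟩ := exists_polynomial_path (M : Matrix (Fin n) (Fin n) K) M.det_coe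
  obtain ⟨Φ, hΦ⟩ := exists_polyCurve_pullback b A
  -- `Q` is nonzero, as its value at the diagonal end of the curve is. Since f vanishes on the curve
  -- wherever `Q` does not, `Q` times the pullback of f is zero, hence f is zero on the whole curve.
  let Q : K[X] := ∏ j, (leadingSubmatrix (A : Matrix (Fin n) (Fin n) K[X]) j).det
  have hQ (r : K) : Q.eval r =
      ∏ j, (leadingSubmatrix ((A : Matrix (Fin n) (Fin n) K[X]).map (eval r)) j).det := by
    rw [eval_prod]
    refine Finset.prod_congr rfl fun j _ => ?_
    exact RingHom.map_det (evalRingHom r) _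
  have hD : ∏ i, D i = 1 := by
    rw [← Matrix.det_diagonal, ← hA0]
    have := (Matrix.SpecialLinearGroup.map (evalRingHom (0 : K)) A).det_coe
    exact this
  have hQ0 : Q ≠ 0 := by
    intro h0
    have h1 := hQ 0
    rw [h0, eval_zero, hA0] at h1
    refine Finset.prod_ne_zero_iff.2 (fun j _ => ?_) h1.symm
    have : leadingSubmatrix (Matrix.diagonal D) j =
        Matrix.diagonal fun i : {i // i < j} => D i := by
      exact Matrix.submatrix_diagonal _ _ Subtype.val_injective
    rw [this, Matrix.det_diagonal]
    exact Finset.prod_ne_zero_iff.2 fun i _ h2 =>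
      one_ne_zero (hD.symm.trans (Finset.prod_eq_zero (Finset.mem_univ _) h2))
  have hmul : Q * Φ ⟨f, hf⟩ = 0 := by
    refine funext fun r => ?_
    rw [eval_mul, eval_zero, mul_eq_zero, or_iff_not_imp_left]
    intro hr
    rw [hΦ]
    refine h _ fun j => ?_
    rw [hQ, ← ne_eq, Finset.prod_ne_zero_iff] at hr
    exact hr j (Finset.mem_univ j)
  have h0 := (mul_eq_zero.1 hmul).resolve_left hQ0
  have h1 := hΦ ⟨f, hf⟩ 1
  rw [h0, eval_zero, polyCurve_eq b A 1 (B := M) fun i j => congrFun (congrFun hA1 i) j] at h1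
  exact h1.symm

/-- The conjugates of a lower unitriangular matrix by a one-parameter group of diagonal matrices
that contracts it to the identity. -/
theorem exists_contraction [IsAlgClosed K] (L : Matrix.SpecialLinearGroup (Fin n) K)
    (hL : IsLowerUnitriangular (L : Matrix (Fin n) (Fin n) K)) :
    ∃ A : Matrix.SpecialLinearGroup (Fin n) K[X], polyCurve b A 0 = 1 ∧
      ∀ (r μ : K) (t : SpecialLinearGroup K V), r ≠ 0 →
        IsDiagonal b t (fun i => μ * r ^ (i : ℕ)) →
        polyCurve b A r * t = t * slOfMatrix b L := by
  -- Conjugation by diag(μ r^i) scales entry (i, j) by r^{i−j}. The truncated subtraction is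
  -- harmless, as `L` vanishes above the diagonal.
  let B : Matrix (Fin n) (Fin n) K[X] := Matrix.of fun i j => C (L i j) * X ^ ((i : ℕ) - j)
  have hdet : B.det = 1 := by
    rw [Matrix.det_of_isLowerTriangular B fun i j h => ?_]
    · simp [B, hL.2]
    · have h' : i < j := h
      simp [B, hL.1 i j h']
  have hB (r : K) (i j : Fin n) : (B i j).eval r = L i j * r ^ ((i : ℕ) - j) := by simp [B]
  let B' : Matrix.SpecialLinearGroup (Fin n) K[X] := ⟨B, hdet⟩
  refine ⟨B', ?_, fun r μ t hr ht => ?_⟩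
  · rw [polyCurve_eq b _ 0 (B := 1), map_one]
    intro i j
    refine (hB 0 i j).trans ?_
    rw [Matrix.SpecialLinearGroup.coe_one]
    rcases lt_trichotomy i j with h | h | h
    · rw [hL.1 i j h, Matrix.one_apply_ne h.ne, zero_mul]
    · subst h
      simp [hL.2]
    · have h' : (i : ℕ) - j ≠ 0 := by
        have := Fin.lt_def.1 h
        omega
      rw [Matrix.one_apply_ne h.ne', zero_pow h', mul_zero]
  · have htd : (((slOfMatrix b).symm t : Matrix.SpecialLinearGroup (Fin n) K) :
        Matrix (Fin n) (Fin n) K) = Matrix.diagonal fun i : Fin n => μ * r ^ (i : ℕ) := by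
      rw [← toMatrix_natRep, ← LinearMap.toMatrix_toLin b b (Matrix.diagonal _)]
      congr 1
      exact b.ext fun i => (ht i).trans (toLin_diagonal_apply b (fun i : Fin n => μ * r ^ (i : ℕ)) i).symm
    apply (slOfMatrix b).symm.injective
    rw [map_mul, map_mul, MulEquiv.symm_apply_apply, polyCurve, MulEquiv.symm_apply_apply]
    ext i j
    rw [Matrix.SpecialLinearGroup.coe_mul, Matrix.SpecialLinearGroup.coe_mul, htd,
      Matrix.mul_diagonal, Matrix.diagonal_mul]
    change (B i j).eval r * _ = _
    rw [hB]
    rcases lt_or_ge i j with h | h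
    · rw [hL.1 i j h, zero_mul, zero_mul, mul_zero]
    · have h1 : r ^ (i : ℕ) = r ^ ((i : ℕ) - j) * r ^ (j : ℕ) := by
        rw [← pow_add, Nat.sub_add_cancel (Fin.le_def.1 h)]
      rw [h1]
      ring

theorem exists_isDiagonal_pow [IsAlgClosed K] [FiniteDimensional K V] (hn : 0 < n) {r : K}
    (hr : r ≠ 0) :
    ∃ (t : SpecialLinearGroup K V) (μ : K), IsDiagonal b t (fun i => μ * r ^ (i : ℕ)) := by
  obtain ⟨μ, hμ⟩ := IsAlgClosed.exists_pow_nat_eq (∏ i : Fin n, r ^ (i : ℕ))⁻¹ hn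
  let T : Matrix.SpecialLinearGroup (Fin n) K :=
    ⟨Matrix.diagonal fun i : Fin n => μ * r ^ (i : ℕ), ?_⟩
  · exact ⟨slOfMatrix b T, μ, fun i => toLin_diagonal_apply b _ i⟩
  rw [Matrix.det_diagonal, Finset.prod_mul_distrib, Finset.prod_const, Finset.card_univ,
    Fintype.card_fin, hμ, inv_mul_cancel₀]
  exact Finset.prod_ne_zero_iff.2 fun i _ => pow_ne_zero _ hr

end BigCell

end JordanSL

namespace JordanSL

open Module Polynomial

/-! ### A highest weight determines the representation. -/

section Uniqueness

variable {K V : Type*} [Field K] [AddCommGroup V] [Module K V] {n : ℕ} {b : Basis (Fin n) K V}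
variable {W : Type*} [AddCommGroup W] [Module K W]
variable {ρ : Representation K (SpecialLinearGroup K V) W} {χ : (Fin n → K) → K} {w : W}

theorem exists_dual_ne_zero (hw : w ≠ 0) : ∃ ψ : Dual K W, ψ w ≠ 0 := by
  by_contra! h
  exact hw ((Module.forall_dual_apply_eq_zero_iff K w).1 h)

/-- In a representation with a highest weight vector `w`, the coefficient of `w` in a combination of
translates of `w` by lower unitriangular elements is the sum of the coefficients. -/
theorem sum_coeff_eq_of_sum_translates_eq [IsAlgClosed K] [FiniteDimensional K V] (hn : 0 < n)
    (hρ : IsRational ρ) (hw : w ≠ 0) (hT : ∀ g s, IsDiagonal b g s → ρ g w = χ s • w)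
    (c : {L : Matrix.SpecialLinearGroup (Fin n) K //
      IsLowerUnitriangular (L : Matrix (Fin n) (Fin n) K)} →₀ K) {β : K}
    (hc : (c.sum fun L a => a • ρ (slOfMatrix b L.1) w) = β • w) : (c.sum fun _ a => a) = β := by
  obtain ⟨ψ, hψ⟩ := exists_dual_ne_zero (K := K) hw
  choose A hA0 hA using fun L : {L : Matrix.SpecialLinearGroup (Fin n) K //
      IsLowerUnitriangular (L : Matrix (Fin n) (Fin n) K)} => exists_contraction b L.1 L.2
  choose Φ hΦ using fun L => exists_polyCurve_pullback b (A L)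
  let f : regularFunctions K V := ⟨_, hρ.2 ψ w⟩
  let P : K[X] := (c.sum fun L a => C a * Φ L f) - C (β * ψ w)
  have hP (r : K) : P.eval r =
      ψ (c.sum fun L a => a • ρ (polyCurve b (A L) r) w) - β * ψ w := by
    simp only [P, eval_sub, eval_C, Finsupp.sum, eval_finsetSum, eval_mul, hΦ, map_sum, map_smul,
      smul_eq_mul, f]
  -- For r ≠ 0 a torus element conjugates the relation `hc` into the same relation along the curves.
  -- The factor X disposes of r = 0, and cancelling it then gives the relation at r = 0, where every
  -- curve is at the identity.
  have hP0 : X * P = 0 := by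
    refine funext fun r => ?_
    rw [eval_mul, eval_X, eval_zero, mul_eq_zero, or_iff_not_imp_left]
    intro hr
    obtain ⟨t, μ, ht⟩ := exists_isDiagonal_pow b hn hr
    set χt := χ fun i : Fin n => μ * r ^ (i : ℕ)
    have hχ : ρ t w = χt • w := hT t _ ht
    have hχ0 : χt ≠ 0 := by
      intro h0
      rw [h0, zero_smul] at hχ
      apply hw
      have : ρ t⁻¹ (ρ t w) = w := by
        rw [← End.mul_apply, ← map_mul, inv_mul_cancel, map_one, End.one_apply]
      rw [← this, hχ, map_zero]
    have hL (L) : χt • ρ (polyCurve b (A L) r) w = ρ t (ρ (slOfMatrix b L.1) w) := by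
      rw [← map_smul, ← hχ, ← End.mul_apply, ← map_mul, hA L r μ t hr ht, map_mul, End.mul_apply]
    have hsum : χt • (c.sum fun L a => a • ρ (polyCurve b (A L) r) w) = χt • (β • w) := by
      rw [smul_comm, ← hχ, ← map_smul, ← hc, Finsupp.sum, Finsupp.sum, Finset.smul_sum, map_sum]
      refine Finset.sum_congr rfl fun L _ => ?_
      rw [smul_comm, hL, map_smul]
    rw [hP, smul_right_injective W hχ0 hsum, map_smul, smul_eq_mul, sub_self]
  have h1 := hP 0
  rw [(mul_eq_zero.1 hP0).resolve_left X_ne_zero, eval_zero] at h1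
  simp only [hA0, map_one, End.one_apply, Finsupp.sum, ← Finset.sum_smul, map_smul,
    smul_eq_mul] at h1
  exact mul_right_cancel₀ hψ (sub_eq_zero.1 h1.symm)

/-- The highest weight determines a rational irreducible representation up to isomorphism. -/
theorem exists_equiv_of_isIrreducibleOfHighestWeight [IsAlgClosed K] [FiniteDimensional K V]
    (hn : 0 < n) {W' : Type*} [AddCommGroup W'] [Module K W']
    {σ : Representation K (SpecialLinearGroup K V) W'}
    (hρ : IsIrreducibleOfHighestWeight b χ ρ) (hσ : IsIrreducibleOfHighestWeight b χ σ) :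
    ∃ φ : W ≃ₗ[K] W', ∀ g w, φ (ρ g w) = σ g (φ w) := by
  obtain ⟨hρ, hρi, w, hw, hwU, hwT⟩ := hρ
  obtain ⟨hσ, hσi, w', hw', hwU', hwT'⟩ := hσ
  -- The submodule generated by the pair of highest weight vectors will be the graph of the
  -- isomorphism.
  let M : Submodule K (W × W') := Submodule.span K (Set.range fun g => (ρ g w, σ g w'))
  let S := {L : Matrix.SpecialLinearGroup (Fin n) K //
      IsLowerUnitriangular (L : Matrix (Fin n) (Fin n) K)}
  let v : S → W × W' := fun L => (ρ (slOfMatrix b L.1) w, σ (slOfMatrix b L.1) w')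
  -- On the big cell every translate is a multiple of a lower unitriangular one. A linear form
  -- killing those gives a regular function that vanishes on the big cell, hence everywhere.
  have hMN : M ≤ Submodule.span K (Set.range v) := by
    rw [Submodule.span_le]
    rintro _ ⟨g, rfl⟩
    by_contra hg
    obtain ⟨Ψ, hΨ, hΨ'⟩ := Submodule.exists_le_ker_of_notMem hg
    have hf : (fun g => Ψ (ρ g w, σ g w')) ∈ regularFunctions K V := by
      have := add_mem (hρ.2 (Ψ ∘ₗ LinearMap.inl K W W') w) (hσ.2 (Ψ ∘ₗ LinearMap.inr K W W') w')
      refine (congrArg (· ∈ regularFunctions K V) (funext fun g => ?_)).mpr this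
      change _ = Ψ (ρ g w, 0) + Ψ (0, σ g w')
      rw [← map_add, Prod.mk_add_mk, add_zero, zero_add]
    refine hΨ (eq_zero_of_eq_zero_on_bigCell b hf (fun A hA => ?_) g)
    obtain ⟨U, T, L, s, hU, hT, hL, h⟩ := exists_bigCell_decomposition b A hA
    have h1 : ρ (slOfMatrix b A) w = χ s • ρ (slOfMatrix b L) w := by
      rw [← hwU U hU, ← End.mul_apply, ← map_mul, h, map_mul, End.mul_apply, hwT T s hT, map_smul,
        hwU U hU]
    have h2 : σ (slOfMatrix b A) w' = χ s • σ (slOfMatrix b L) w' := by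
      rw [← hwU' U hU, ← End.mul_apply, ← map_mul, h, map_mul, End.mul_apply, hwT' T s hT,
        map_smul, hwU' U hU]
    change Ψ (ρ (slOfMatrix b A) w, σ (slOfMatrix b A) w') = 0
    rw [h1, h2, ← Prod.smul_mk, map_smul]
    have h3 : Ψ (v ⟨L, hL⟩) = 0 := hΨ' (Submodule.subset_span ⟨_, rfl⟩)
    rw [show (ρ (slOfMatrix b L) w, σ (slOfMatrix b L) w') = v ⟨L, hL⟩ from rfl, h3, smul_zero]
  -- Both scalars equal the sum of the coefficients of one and the same combination of lower
  -- unitriangular translates.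
  have hβ {β β' : K} (h : (β • w, β' • w') ∈ M) : β = β' := by
    obtain ⟨c, hc⟩ := (Finsupp.mem_span_range_iff_exists_finsupp).1 (hMN h)
    have h1 := congrArg (LinearMap.fst K W W') hc
    have h2 := congrArg (LinearMap.snd K W W') hc
    rw [Finsupp.sum, map_sum] at h1 h2
    rw [← sum_coeff_eq_of_sum_translates_eq hn hρ hw hwT c h1,
      ← sum_coeff_eq_of_sum_translates_eq hn hσ hw' hwT' c h2]
  have hMstab (g) (m) (hm : m ∈ M) : (ρ g m.1, σ g m.2) ∈ M := by
    have : M ≤ M.comap ((ρ g).prodMap (σ g)) := by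
      rw [Submodule.span_le]
      rintro _ ⟨h, rfl⟩
      refine Submodule.subset_span ⟨g * h, ?_⟩
      simp [map_mul]
    exact this hm
  have hwM : (w, w') ∈ M := Submodule.subset_span ⟨1, by simp⟩
  let p₁ : M →ₗ[K] W := LinearMap.fst K W W' ∘ₗ M.subtype
  let p₂ : M →ₗ[K] W' := LinearMap.snd K W W' ∘ₗ M.subtype
  have hp₁s : LinearMap.range p₁ = ⊤ := by
    refine (eq_bot_or_eq_top_of_isIrreducible hρi _ ?_).resolve_left fun h => ?_
    · rintro g _ ⟨m, rfl⟩
      exact ⟨⟨_, hMstab g m m.2⟩, rfl⟩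
    · have h1 : w ∈ LinearMap.range p₁ := ⟨⟨_, hwM⟩, rfl⟩
      rw [h, Submodule.mem_bot] at h1
      exact hw h1
  have hp₂s : LinearMap.range p₂ = ⊤ := by
    refine (eq_bot_or_eq_top_of_isIrreducible hσi _ ?_).resolve_left fun h => ?_
    · rintro g _ ⟨m, rfl⟩
      exact ⟨⟨_, hMstab g m m.2⟩, rfl⟩
    · have h1 : w' ∈ LinearMap.range p₂ := ⟨⟨_, hwM⟩, rfl⟩
      rw [h, Submodule.mem_bot] at h1
      exact hw' h1
  have hp₁i : Function.Injective p₁ := by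
    rw [← LinearMap.ker_eq_bot, LinearMap.ker_eq_bot']
    rintro ⟨⟨x, y⟩, hm⟩ (rfl : x = 0)
    -- The kernel of the projection is a subrepresentation of `W'`; were it everything, (0, w')
    -- would lie in `M`, contradicting `hβ`.
    have hker : M.comap (LinearMap.inr K W W') = ⊥ := by
      refine (eq_bot_or_eq_top_of_isIrreducible hσi _ fun g y hy => ?_).resolve_right fun h => ?_
      · have := hMstab g _ hy
        rwa [LinearMap.inr_apply, map_zero] at this
      · have h1 : w' ∈ M.comap (LinearMap.inr K W W') := by rw [h]; trivial
        exact zero_ne_one (hβ (β := 0) (β' := 1) (by rwa [zero_smul, one_smul]))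
    have hy : y ∈ M.comap (LinearMap.inr K W W') := hm
    rw [hker, Submodule.mem_bot] at hy
    subst hy
    rfl
  have hp₂i : Function.Injective p₂ := by
    rw [← LinearMap.ker_eq_bot, LinearMap.ker_eq_bot']
    rintro ⟨⟨x, y⟩, hm⟩ (rfl : y = 0)
    have hker : M.comap (LinearMap.inl K W W') = ⊥ := by
      refine (eq_bot_or_eq_top_of_isIrreducible hρi _ fun g y hy => ?_).resolve_right fun h => ?_
      · have := hMstab g _ hy
        rwa [LinearMap.inl_apply, map_zero] at this
      · have h1 : w ∈ M.comap (LinearMap.inl K W W') := by rw [h]; trivial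
        exact one_ne_zero (hβ (β := 1) (β' := 0) (by rwa [zero_smul, one_smul]))
    have hy : x ∈ M.comap (LinearMap.inl K W W') := hm
    rw [hker, Submodule.mem_bot] at hy
    subst hy
    rfl
  let φ₁ : M ≃ₗ[K] W := LinearEquiv.ofBijective p₁ ⟨hp₁i, LinearMap.range_eq_top.1 hp₁s⟩
  let φ₂ : M ≃ₗ[K] W' := LinearEquiv.ofBijective p₂ ⟨hp₂i, LinearMap.range_eq_top.1 hp₂s⟩
  refine ⟨φ₁.symm.trans φ₂, fun g x => ?_⟩
  obtain ⟨m, rfl⟩ := φ₁.surjective x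
  have h1 : ρ g (φ₁ m) = φ₁ ⟨_, hMstab g m m.2⟩ := rfl
  rw [h1, LinearEquiv.trans_apply, LinearEquiv.trans_apply, LinearEquiv.symm_apply_apply,
    LinearEquiv.symm_apply_apply]
  rfl

theorem IsDifferential.conj {W' : Type*} [AddCommGroup W'] [Module K W']
    {σ : Representation K (SpecialLinearGroup K V) W'} {e : sl K V} {D : End K W'}
    (h : IsDifferential σ e D) (φ : W ≃ₗ[K] W') (hφ : ∀ g w, φ (ρ g w) = σ g (φ w)) :
    IsDifferential ρ e (φ.symm.conj D) := by
  obtain ⟨δ, h1, h2, h3⟩ := h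
  refine ⟨δ, h1, h2, fun ψ w => ?_⟩
  obtain ⟨h4, h5⟩ := h3 (ψ ∘ₗ φ.symm.toLinearMap) (φ w)
  have h6 : (fun g => ψ (ρ g w)) = fun g => (ψ ∘ₗ φ.symm.toLinearMap) (σ g (φ w)) := by
    funext g
    rw [← hφ]
    simp
  refine ⟨by rw [h6]; exact h4, ?_⟩
  have h7 : ψ ((φ.symm.conj D) w) = (ψ ∘ₗ φ.symm.toLinearMap) (D (φ w)) := by
    simp [LinearEquiv.conj_apply]
  rw [h7, h5]
  congr 1
  exact Subtype.ext h6.symm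

end Uniqueness

end JordanSL

theorem corollary1p5 {K : Type*} [Field K] [IsAlgClosed K] (p : ℕ) [Fact p.Prime] [CharP K p]
    {V : Type*} [AddCommGroup V] [Module K V] [FiniteDimensional K V]
    (n : ℕ) (hn : 2 ≤ n) (hV : Module.finrank K V = n)
    (e : JordanSL.sl K V) (u : SpecialLinearGroup K V)
    {t : ℕ} (d : Fin t → ℕ)
    (he : JordanSL.HasJordanBlocks (e : Module.End K V) 0 d)
    (hu : JordanSL.HasJordanBlocks (JordanSL.natRep K V u) 1 d)
    (α : ℕ) (hα : α = padicValNat p (Finset.univ.gcd d)) :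
    -- the actions on `𝔤𝔩(V)` and on `𝔰𝔩(V)`
    JordanSL.SameJordanBlockSizes (JordanSL.glRep K V u) (JordanSL.glAct e) ∧
    JordanSL.SameJordanBlockSizes (JordanSL.slRep K V u) (JordanSL.slAct e) ∧
    -- the actions on `𝔭𝔰𝔩(V)`
    (p ∣ n → (JordanSL.SameJordanBlockSizes (JordanSL.pslRep K V u) (JordanSL.pslAct e) ↔
      p ^ (α + 1) ∣ n)) ∧
    (¬ p ∣ n → JordanSL.SameJordanBlockSizes (JordanSL.pslRep K V u) (JordanSL.pslAct e)) ∧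
    -- `𝔭𝔰𝔩(V)` is `L_G(ϖ_1 + ϖ_{n-1})`, and the same comparison on every model of the latter
    ∀ b : Module.Basis (Fin n) K V,
      JordanSL.IsAdjointSimple b (JordanSL.pslRep K V) ∧
      ∀ (W : Type*) [AddCommGroup W] [Module K W]
        (ρ : Representation K (SpecialLinearGroup K V) W), JordanSL.IsAdjointSimple b ρ →
        ∃ D : Module.End K W, JordanSL.IsDifferential ρ e D ∧
          (∀ D' : Module.End K W, JordanSL.IsDifferential ρ e D' → D' = D) ∧
          (∃ φ : W ≃ₗ[K] JordanSL.psl K V,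
            (∀ g w, φ (ρ g w) = JordanSL.pslRep K V g (φ w)) ∧
            ∀ w, φ (D w) = JordanSL.pslAct e (φ w)) ∧
          (p ∣ n → (JordanSL.SameJordanBlockSizes (ρ u) D ↔ p ^ (α + 1) ∣ n)) ∧
          (¬ p ∣ n → JordanSL.SameJordanBlockSizes (ρ u) D) := by
  have hpos : 0 < Module.finrank K V := by omega
  have : Nontrivial V := Module.nontrivial_of_finrank_pos hpos
  have : Infinite K := IsAlgClosed.instInfinite
  subst hα
  -- Only `u` is conjugated and `e` stays put: block sizes of the two actions are compared
  -- separately, so this loses nothing.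
  obtain ⟨g, hg⟩ := JordanSL.exists_conj_eq_one_add he hu
  have henil := he.isNilpotent
  have hpsl : p ∣ n → (JordanSL.SameJordanBlockSizes (JordanSL.pslRep K V u) (JordanSL.pslAct e) ↔
      p ^ (padicValNat p (Finset.univ.gcd d) + 1) ∣ n) := fun hp => by
    rw [← JordanSL.sameJordanBlockSizes_conj_iff _ g, ← hV]
    exact JordanSL.sameJordanBlockSizes_pslRep_iff_dvd (hV ▸ hp) hg he
  have hpsl' : ¬ p ∣ n →
      JordanSL.SameJordanBlockSizes (JordanSL.pslRep K V u) (JordanSL.pslAct e) := fun hp =>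
    (JordanSL.sameJordanBlockSizes_conj_iff _ g _ _).1
      (JordanSL.sameJordanBlockSizes_pslRep_of_not_dvd (hV ▸ hp) hg henil)
  refine ⟨(JordanSL.sameJordanBlockSizes_conj_iff _ g _ _).1
      (JordanSL.sameJordanBlockSizes_glRep hg henil),
    (JordanSL.sameJordanBlockSizes_conj_iff _ g _ _).1
      (JordanSL.sameJordanBlockSizes_slRep hg henil), hpsl, hpsl', fun b => ?_⟩
  have hadj := JordanSL.isAdjointSimple_pslRep hn b
  refine ⟨hadj, fun W _ _ ρ hρ => ?_⟩
  obtain ⟨φ, hφ⟩ := JordanSL.exists_equiv_of_isIrreducibleOfHighestWeight (by omega) hρ hadj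
  have hD := (JordanSL.isDifferential_pslRep henil).conj φ hφ
  have hφD (w : W) : φ (φ.symm.conj (JordanSL.pslAct e) w) = JordanSL.pslAct e (φ w) := by
    simp [LinearEquiv.conj_apply]
  have hsame : JordanSL.SameJordanBlockSizes (ρ u) (φ.symm.conj (JordanSL.pslAct e)) ↔
      JordanSL.SameJordanBlockSizes (JordanSL.pslRep K V u) (JordanSL.pslAct e) :=
    ⟨fun h => h.conj φ φ (hφ u) hφD, fun h => h.conj φ.symm φ.symm
      (fun w => by rw [LinearEquiv.symm_apply_eq, hφ, LinearEquiv.apply_symm_apply])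
      (fun w => by rw [LinearEquiv.symm_apply_eq, hφD, LinearEquiv.apply_symm_apply])⟩
  refine ⟨_, hD, fun D' hD' => hD.unique hD', ⟨φ, hφ, hφD⟩, fun hp => ?_, fun hp => ?_⟩
  · rw [hsame]
    exact hpsl hp
  · exact hsame.2 (hpsl' hp)
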